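/- Let $\Sigma$ be a connected smooth surface (without boundary), let $\Phi\colon\Sigma\to\mathbb R^3$ be a smooth immersion with smooth unit normal field $N\colon\Sigma\to\mathbb R^3$, and let $S$ be the shape operator, $dN=-d\Phi\circ S$, with Gauss curvature $K=\det S$ and mean curvature $H=\tfrac12\operatorname{tr}S$. Let $\alpha,\lambda\in\mathbb R$ with $\alpha\neq0$. Call $\Sigma$ a $\lambda$-shrinker of the Gauss curvature flow if $$K=\alpha\langle N,\Phi\rangle+\lambda\quad\text{on }\Sigma .$$ **Theorem 1.2.** If $\Sigma$ is a $\lambda$-shrinker with constant mean curvature, then $\Sigma$ is (an open piece of) a plane, a sphere or a circular cylinder; that is, $\Phi(\Sigma)$ is a relatively open subset of a plane, of a round sphere or of a circular cylinder of $\mathbb R^3$. Conversely, such surfaces occur: $\Sigma$ is a $\lambda$-shrinker with constant mean curvature whenever 1. $\Phi(\Sigma)$ lies in a plane $\{x:\langle w,x\rangle=d\}$ with $|w|=1$, $N\equiv w$ and $\lambda=-\alpha d$ (in particular, planes through the origin for $\lambda=0$); 2. $\Phi(\Sigma)$ lies in the sphere of radius $r>0$ centred at the origin, $N=-\Phi/r$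 is the inward normal, and $\lambda r^2-\alpha r^3-1=0$; 3. $\Phi(\Sigma)$ lies in a circular cylinder of radius $r>0$ whose axis passes through the origin, $N$ is the inward normal, and $\lambda-\alpha r=0$. -/

import Mathlib

open scoped Manifold ContDiff

noncomputable section

/-- Euclidean space `ℝ³`. -/
abbrev E3 : Type := EuclideanSpace ℝ (Fin 3)

section Surface

variable {M : Type*} [TopologicalSpace M] [ChartedSpace (EuclideanSpace ℝ (Fin 2)) M]

/-- The differential at `p` of a map from the surface `M` to `ℝ³`. -/
def surfDiff (F : M → E3) (p : M) : TangentSpace (𝓡 2) p →ₗ[ℝ] E3 :=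
  (mfderiv (𝓡 2) 𝓘(ℝ, E3) F p : TangentSpace (𝓡 2) p →L[ℝ] E3).toLinearMap

/-- `Φ : M → ℝ³` is a smooth immersion of the surface `M`, oriented by the smooth unit normal
field (Gauss map) `N`. -/
structure IsOrientedImmersion (Φ N : M → E3) : Prop where
  smooth : ContMDiff (𝓡 2) 𝓘(ℝ, E3) ∞ Φ
  smooth_normal : ContMDiff (𝓡 2) 𝓘(ℝ, E3) ∞ N
  injective : ∀ p, Function.Injective (surfDiff Φ p)
  norm_normal : ∀ p, ‖N p‖ = 1
  inner_normal : ∀ p v, inner ℝ (N p) (surfDiff Φ p v) = 0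

/-- The shape operator `S` of an oriented immersion, the endomorphism of the tangent plane with
`dΦ ∘ S = -dN` (Weingarten formula). The values of `dN` are tangent to the surface, so they may be
pulled back by any left inverse of the injective map `dΦ`; see `surfDiff_shapeOperator`. -/
def shapeOperator (Φ N : M → E3) (p : M) :
    TangentSpace (𝓡 2) p →ₗ[ℝ] TangentSpace (𝓡 2) p :=
  -((surfDiff Φ p).leftInverse ∘ₗ surfDiff N p)

/-- The Gauss curvature `K = det S = κ₁ κ₂`. -/
def gaussCurvature (Φ N : M → E3) (p : M) : ℝ :=
  LinearMap.det (shapeOperator Φ N p)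

/-- The mean curvature `H = (tr S) / 2 = (κ₁ + κ₂) / 2`. -/
def meanCurvature (Φ N : M → E3) (p : M) : ℝ :=
  LinearMap.trace ℝ (TangentSpace (𝓡 2) p) (shapeOperator Φ N p) / 2

/-- The immersion has constant mean curvature. -/
def HasConstantMeanCurvature (Φ N : M → E3) : Prop :=
  ∃ H : ℝ, ∀ p, meanCurvature Φ N p = H

/-- The `lam`-shrinker equation `K = α ⟨N, Φ⟩ + lam` of the Gauss curvature flow. -/
def IsGCFShrinker (α lam : ℝ) (Φ N : M → E3) : Prop :=
  ∀ p, gaussCurvature Φ N p = α * inner ℝ (N p) (Φ p) + lam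

end Surface

/-- The plane `⟨w, x⟩ = d`. -/
def planeSet (w : E3) (d : ℝ) : Set E3 := {x | inner ℝ w x = d}

/-- The component of `x` orthogonal to the unit vector `u`. -/
def orthPart (u x : E3) : E3 := x - (inner ℝ u x : ℝ) • u

/-- The circular cylinder of radius `r` whose axis is the line through `c` with unit
direction `u`. -/
def cylinderSet (c u : E3) (r : ℝ) : Set E3 := {x | ‖orthPart u (x - c)‖ = r}

/-- `P` is an affine plane. -/
def IsPlane (P : Set E3) : Prop := ∃ (w : E3) (d : ℝ), ‖w‖ = 1 ∧ P = planeSet w d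

/-- `P` is a round sphere of positive radius. -/
def IsRoundSphere (P : Set E3) : Prop := ∃ (c : E3) (r : ℝ), 0 < r ∧ P = Metric.sphere c r

/-- `P` is a circular cylinder of positive radius. -/
def IsCircularCylinder (P : Set E3) : Prop :=
  ∃ (c u : E3) (r : ℝ), ‖u‖ = 1 ∧ 0 < r ∧ P = cylinderSet c u r

/-- `A` is a relatively open subset of `P`. -/
def IsOpenPieceOf (A P : Set E3) : Prop := ∃ U : Set E3, IsOpen U ∧ A = P ∩ U

section WellDefined

variable {M : Type*} [TopologicalSpace M] [ChartedSpace (EuclideanSpace ℝ (Fin 2)) M]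

/-- The differential of the Gauss map takes values orthogonal to the normal. -/
theorem inner_surfDiff_normal {Φ N : M → E3} (h : IsOrientedImmersion Φ N) (p : M)
    (v : TangentSpace (𝓡 2) p) : inner ℝ (N p) (surfDiff N p v) = 0 := by
  have hN : MDifferentiableAt (𝓡 2) 𝓘(ℝ, E3) N p :=
    (h.smooth_normal p).mdifferentiableAt (by simp)
  have hd : HasMFDerivAt (𝓡 2) 𝓘(ℝ, E3) N p (mfderiv (𝓡 2) 𝓘(ℝ, E3) N p) := hN.hasMFDerivAt
  have hq : HasFDerivAt (fun x : E3 => ‖x‖ ^ 2) (2 • (innerSL ℝ (N p))) (N p) :=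
    (hasStrictFDerivAt_norm_sq (N p)).hasFDerivAt
  have hc := HasMFDerivAt.comp p hq.hasMFDerivAt hd
  have hconst : ((fun x : E3 => ‖x‖ ^ 2) ∘ N) = fun _ => (1 : ℝ) := by
    funext q; simp [h.norm_normal q]
  rw [hconst] at hc
  have h0 := hasMFDerivAt_unique hc (hasMFDerivAt_const (I := 𝓡 2) (I' := 𝓘(ℝ, ℝ)) (1 : ℝ) p)
  have h1 := congrArg (fun L : TangentSpace (𝓡 2) p →L[ℝ] ℝ => L v) h0
  have h2 : 2 * inner ℝ (N p) (surfDiff N p v) = 0 := by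
    have h3 : (2 • innerSL ℝ (N p) : E3 →L[ℝ] ℝ) (surfDiff N p v) = 0 := h1
    simpa using h3
  linarith

/-- The Weingarten formula `dΦ (S v) = -dN v`, which determines `S` because `dΦ` is injective. -/
theorem surfDiff_shapeOperator {Φ N : M → E3} (h : IsOrientedImmersion Φ N) (p : M)
    (v : TangentSpace (𝓡 2) p) :
    surfDiff Φ p (shapeOperator Φ N p v) = -surfDiff N p v := by
  have hinj : LinearMap.ker (surfDiff Φ p) = ⊥ := LinearMap.ker_eq_bot.mpr (h.injective p)
  have hrange : LinearMap.range (surfDiff Φ p) = (ℝ ∙ N p)ᗮ := by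
    apply Submodule.eq_of_le_of_finrank_eq
    · rintro _ ⟨w, rfl⟩
      exact Submodule.mem_orthogonal_singleton_iff_inner_right.mpr (h.inner_normal p w)
    · rw [LinearMap.finrank_range_of_inj (h.injective p)]
      have hne : N p ≠ 0 := by
        intro h0; have := h.norm_normal p; simp [h0] at this
      have : Fact (Module.finrank ℝ E3 = 2 + 1) := ⟨by simp⟩
      rw [Submodule.finrank_orthogonal_span_singleton (n := 2) hne]
      exact finrank_euclideanSpace_fin
  have hmem : surfDiff N p v ∈ LinearMap.range (surfDiff Φ p) := by
    rw [hrange]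
    exact Submodule.mem_orthogonal_singleton_iff_inner_right.mpr (inner_surfDiff_normal h p v)
  obtain ⟨w, hw⟩ := hmem
  have hl : (surfDiff Φ p).leftInverse (surfDiff Φ p w) = w :=
    LinearMap.leftInverse_apply_of_inj hinj w
  simp [shapeOperator, ← hw, hl]

end WellDefined

end

/-! Away from umbilics there is a smooth orthonormal principal frame `e₁`, `e₂` with curvatures `H +
s` and `H - s`. Write `a = ⟨∇_{e₁} e₁, e₂⟩` and `b = ⟨∇_{e₂} e₂, e₁⟩`. As `H` is constant, Codazzi
says `e₂ s = 2sa` and `e₁ s = 2sb`, and the Gauss equation expresses `e₁ b + e₂ a` through `s`, `a`,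
`b`. Differentiating the shrinker equation gives `4s²b = α(H + s)⟨ψ, e₁⟩` and its mirror image for
`a`; differentiating once more and inserting into Gauss makes `8s²(a² + b²)` a polynomial in `s`
(`eight_mul_sq_mul_conn_sq`).

The derivative of that relation along `e₁` reduces to `b · P(s) = 0` with a nonzero polynomial `P`
(`conn_right_mul_poly`). If `b ≠ 0` at a point, then `s` takes values among the roots of `P` nearby,
so it is locally constant, and `e₁ s = 2sb` forces `b = 0`. Hence `a = b = 0`, and Gauss yields `s²
= H²`: the surface is flat off its umbilics, with a flat direction that is parallel in space.

Globally `K` is continuous with values in `{H², 0}`, hence constant by connectedness. Either every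
point is umbilic, and `N` or `Φ + H⁻¹ N` is constant (plane or sphere), or the curvatures are `0`
and `2H ≠ 0` everywhere, and the projection of `Φ + (2H)⁻¹ N` along the flat direction is constant
(cylinder). That the image is relatively open follows from the normal tube,
`IsOrientedImmersion.isOpenPieceOf`. The converse is a direct computation of curvatures. -/

open scoped Manifold ContDiff

noncomputable section

/-! ### Derivatives along vector fields in a parameter domain. -/

section DirDeriv

variable {V F : Type*} [NormedAddCommGroup V] [NormedSpace ℝ V]
  [NormedAddCommGroup F] [NormedSpace ℝ F]

/-- The derivative of `f` along the vector field `e`. -/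
def dirDeriv (e : V → V) (f : V → F) (x : V) : F := fderiv ℝ f x (e x)

theorem ContDiffOn.differentiableAt_of_isOpen {U : Set V} {f : V → F} (hf : ContDiffOn ℝ ∞ f U)
    (hU : IsOpen U) {x : V} (hx : x ∈ U) : DifferentiableAt ℝ f x :=
  (hf.contDiffAt (hU.mem_nhds hx)).differentiableAt (by simp)

theorem ContDiffOn.dirDeriv {U : Set V} {e : V → V} {f : V → F} (hf : ContDiffOn ℝ ∞ f U)
    (he : ContDiffOn ℝ ∞ e U) (hU : IsOpen U) : ContDiffOn ℝ ∞ (dirDeriv e f) U :=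
  (hf.fderiv_of_isOpen hU (by simp)).clm_apply he

theorem dirDeriv_congr {U : Set V} {e : V → V} {f g : V → F} (hU : IsOpen U)
    (h : ∀ x ∈ U, f x = g x) {x : V} (hx : x ∈ U) : dirDeriv e f x = dirDeriv e g x := by
  have : f =ᶠ[nhds x] g := Filter.eventuallyEq_of_mem (hU.mem_nhds hx) h
  simp [dirDeriv, this.fderiv_eq]

theorem dirDeriv_const (e : V → V) (c : F) (x : V) : dirDeriv e (fun _ => c) x = 0 := by
  simp [dirDeriv]

theorem dirDeriv_add {e : V → V} {f g : V → F} {x : V} (hf : DifferentiableAt ℝ f x)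
    (hg : DifferentiableAt ℝ g x) :
    dirDeriv e (fun y => f y + g y) x = dirDeriv e f x + dirDeriv e g x := by
  simp [dirDeriv, fderiv_fun_add hf hg]

theorem dirDeriv_neg (e : V → V) (f : V → F) (x : V) :
    dirDeriv e (fun y => -f y) x = -dirDeriv e f x := by
  simp [dirDeriv]

theorem dirDeriv_smul {e : V → V} {c : V → ℝ} {f : V → F} {x : V} (hc : DifferentiableAt ℝ c x)
    (hf : DifferentiableAt ℝ f x) :
    dirDeriv e (fun y => c y • f y) x = c x • dirDeriv e f x + dirDeriv e c x • f x := by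
  simp [dirDeriv, fderiv_fun_smul hc hf]

theorem dirDeriv_mul {e : V → V} {f g : V → ℝ} {x : V} (hf : DifferentiableAt ℝ f x)
    (hg : DifferentiableAt ℝ g x) :
    dirDeriv e (fun y => f y * g y) x = f x * dirDeriv e g x + dirDeriv e f x * g x := by
  simp [dirDeriv, fderiv_fun_mul hf hg]
  ring

theorem dirDeriv_comp {e : V → V} {g : ℝ → ℝ} {f : V → ℝ} {g' : ℝ} {x : V}
    (hg : HasDerivAt g g' (f x)) (hf : DifferentiableAt ℝ f x) :
    dirDeriv e (fun y => g (f y)) x = g' * dirDeriv e f x := by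
  have := (hg.comp_hasFDerivAt x hf.hasFDerivAt).fderiv
  rw [Function.comp_def] at this
  simp [dirDeriv, this]

theorem dirDeriv_inner {G : Type*} [NormedAddCommGroup G] [InnerProductSpace ℝ G] {e : V → V}
    {f g : V → G} {x : V} (hf : DifferentiableAt ℝ f x) (hg : DifferentiableAt ℝ g x) :
    dirDeriv e (fun y => inner ℝ (f y) (g y)) x
      = inner ℝ (f x) (dirDeriv e g x) + inner ℝ (dirDeriv e f x) (g x) := by
  simp [dirDeriv, fderiv_inner_apply ℝ hf hg]

/-- Symmetry of the second derivative cancels the second-order terms; what remains is `f`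
differentiated along the Lie bracket of `e₁` and `e₂`. -/
theorem dirDeriv_dirDeriv_sub {U : Set V} {e₁ e₂ : V → V} {f : V → F} (hU : IsOpen U)
    (hf : ContDiffOn ℝ ∞ f U) (h₁ : ContDiffOn ℝ ∞ e₁ U) (h₂ : ContDiffOn ℝ ∞ e₂ U)
    {x : V} (hx : x ∈ U) :
    dirDeriv e₁ (dirDeriv e₂ f) x - dirDeriv e₂ (dirDeriv e₁ f) x
      = fderiv ℝ f x (dirDeriv e₁ e₂ x - dirDeriv e₂ e₁ x) := by
  have hsymm : IsSymmSndFDerivAt ℝ f x :=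
    (hf.contDiffAt (hU.mem_nhds hx)).isSymmSndFDerivAt
      (by simpa using WithTop.coe_le_coe.mpr (le_top : (2 : ℕ∞) ≤ ⊤))
  have hdf : DifferentiableAt ℝ (fderiv ℝ f) x :=
    (hf.fderiv_of_isOpen hU (m := ∞) (by simp)).differentiableAt_of_isOpen hU hx
  have key : ∀ e e' : V → V, DifferentiableAt ℝ e' x →
      dirDeriv e (dirDeriv e' f) x
        = fderiv ℝ (fderiv ℝ f) x (e x) (e' x) + fderiv ℝ f x (dirDeriv e e' x) := by
    intro e e' he'
    have : fderiv ℝ (dirDeriv e' f) x = _ := fderiv_clm_apply hdf he'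
    simp [dirDeriv] at this ⊢
    rw [this]
    simp [add_comm]
  rw [key e₁ e₂ (h₂.differentiableAt_of_isOpen hU hx),
    key e₂ e₁ (h₁.differentiableAt_of_isOpen hU hx), hsymm (e₁ x) (e₂ x), map_sub]
  abel

end DirDeriv

/-- Two vectors of `ℝ³` with the same coordinates in an orthonormal frame are equal. -/
theorem eq_of_inner_orthonormal {a b c : E3} (haa : inner ℝ a a = (1 : ℝ))
    (hbb : inner ℝ b b = (1 : ℝ)) (hcc : inner ℝ c c = (1 : ℝ)) (hab : inner ℝ a b = (0 : ℝ))
    (hac : inner ℝ a c = (0 : ℝ)) (hbc : inner ℝ b c = (0 : ℝ)) {X Y : E3}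
    (h₁ : inner ℝ a X = (inner ℝ a Y : ℝ)) (h₂ : inner ℝ b X = (inner ℝ b Y : ℝ))
    (h₃ : inner ℝ c X = (inner ℝ c Y : ℝ)) : X = Y := by
  have hon : Orthonormal ℝ ![a, b, c] := by
    rw [orthonormal_iff_ite]
    intro i j
    have hba := real_inner_comm a b
    have hca := real_inner_comm a c
    have hcb := real_inner_comm b c
    rw [hab] at hba
    rw [hac] at hca
    rw [hbc] at hcb
    fin_cases i <;> fin_cases j <;>
      simp [-inner_self_eq_norm_sq_to_K, haa, hbb, hcc, hab, hac, hbc, hba, hca, hcb]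
  have hspan : Submodule.span ℝ (Set.range ![a, b, c]) = ⊤ :=
    hon.linearIndependent.span_eq_top_of_card_eq_finrank' (by simp)
  apply (OrthonormalBasis.mk hon hspan.ge).repr.injective
  ext i
  rw [OrthonormalBasis.repr_apply_apply, OrthonormalBasis.repr_apply_apply]
  fin_cases i <;> simp [h₁, h₂, h₃]

/-! ### Principal frames: structure equations, Codazzi and Gauss. -/

/-- A smooth orthonormal frame of principal directions `e₁`, `e₂` on `U`, with principal
curvatures `H + s` and `H - s`, of the parametrized surface `ψ` with unit normal `n`. -/
structure PrincipalFrame (ψ n : EuclideanSpace ℝ (Fin 2) → E3) (H : ℝ)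
    (s : EuclideanSpace ℝ (Fin 2) → ℝ)
    (e₁ e₂ : EuclideanSpace ℝ (Fin 2) → EuclideanSpace ℝ (Fin 2))
    (U : Set (EuclideanSpace ℝ (Fin 2))) : Prop where
  isOpen : IsOpen U
  smooth_param : ContDiffOn ℝ ∞ ψ U
  smooth_normal : ContDiffOn ℝ ∞ n U
  smooth_s : ContDiffOn ℝ ∞ s U
  smooth_left : ContDiffOn ℝ ∞ e₁ U
  smooth_right : ContDiffOn ℝ ∞ e₂ U
  s_ne_zero : ∀ x ∈ U, s x ≠ 0
  injective : ∀ x ∈ U, Function.Injective (fderiv ℝ ψ x)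
  inner_left : ∀ x ∈ U, inner ℝ (dirDeriv e₁ ψ x) (dirDeriv e₁ ψ x) = (1 : ℝ)
  inner_right : ∀ x ∈ U, inner ℝ (dirDeriv e₂ ψ x) (dirDeriv e₂ ψ x) = (1 : ℝ)
  inner_left_right : ∀ x ∈ U, inner ℝ (dirDeriv e₁ ψ x) (dirDeriv e₂ ψ x) = (0 : ℝ)
  inner_normal_normal : ∀ x ∈ U, inner ℝ (n x) (n x) = (1 : ℝ)
  inner_normal_left : ∀ x ∈ U, inner ℝ (n x) (dirDeriv e₁ ψ x) = (0 : ℝ)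
  inner_normal_right : ∀ x ∈ U, inner ℝ (n x) (dirDeriv e₂ ψ x) = (0 : ℝ)
  dirDeriv_left_normal : ∀ x ∈ U, dirDeriv e₁ n x = -((H + s x) • dirDeriv e₁ ψ x)
  dirDeriv_right_normal : ∀ x ∈ U, dirDeriv e₂ n x = -((H - s x) • dirDeriv e₂ ψ x)

namespace PrincipalFrame

variable {ψ n : EuclideanSpace ℝ (Fin 2) → E3} {H : ℝ} {s : EuclideanSpace ℝ (Fin 2) → ℝ}
  {e₁ e₂ : EuclideanSpace ℝ (Fin 2) → EuclideanSpace ℝ (Fin 2)}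
  {U : Set (EuclideanSpace ℝ (Fin 2))}

/-- The symmetry `e₁ ↔ e₂`, `s ↔ -s` yields the mirror image of every identity below without a
second computation. -/
theorem swap (h : PrincipalFrame ψ n H s e₁ e₂ U) :
    PrincipalFrame ψ n H (fun x => -s x) e₂ e₁ U where
  isOpen := h.isOpen
  smooth_param := h.smooth_param
  smooth_normal := h.smooth_normal
  smooth_s := h.smooth_s.neg
  smooth_left := h.smooth_right
  smooth_right := h.smooth_left
  s_ne_zero x hx := neg_ne_zero.mpr (h.s_ne_zero x hx)
  injective := h.injective
  inner_left := h.inner_right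
  inner_right := h.inner_left
  inner_left_right x hx := by rw [real_inner_comm]; exact h.inner_left_right x hx
  inner_normal_normal := h.inner_normal_normal
  inner_normal_left := h.inner_normal_right
  inner_normal_right := h.inner_normal_left
  dirDeriv_left_normal x hx := by rw [h.dirDeriv_right_normal x hx, sub_eq_add_neg]
  dirDeriv_right_normal x hx := by rw [h.dirDeriv_left_normal x hx, sub_neg_eq_add]

/-- The connection coefficient `⟨∇_{e₁} e₁, e₂⟩`. -/
def conn (ψ : EuclideanSpace ℝ (Fin 2) → E3)
    (e₁ e₂ : EuclideanSpace ℝ (Fin 2) → EuclideanSpace ℝ (Fin 2))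
    (x : EuclideanSpace ℝ (Fin 2)) : ℝ :=
  inner ℝ (dirDeriv e₁ (dirDeriv e₁ ψ) x) (dirDeriv e₂ ψ x)

theorem smooth_dirDeriv_left (h : PrincipalFrame ψ n H s e₁ e₂ U) :
    ContDiffOn ℝ ∞ (dirDeriv e₁ ψ) U :=
  h.smooth_param.dirDeriv h.smooth_left h.isOpen

theorem smooth_conn (h : PrincipalFrame ψ n H s e₁ e₂ U) : ContDiffOn ℝ ∞ (conn ψ e₁ e₂) U :=
  (h.smooth_dirDeriv_left.dirDeriv h.smooth_left h.isOpen).inner ℝ h.swap.smooth_dirDeriv_left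

theorem ext_inner (h : PrincipalFrame ψ n H s e₁ e₂ U) {x : EuclideanSpace ℝ (Fin 2)}
    (hx : x ∈ U) {X Y : E3}
    (h₁ : inner ℝ (dirDeriv e₁ ψ x) X = (inner ℝ (dirDeriv e₁ ψ x) Y : ℝ))
    (h₂ : inner ℝ (dirDeriv e₂ ψ x) X = (inner ℝ (dirDeriv e₂ ψ x) Y : ℝ))
    (h₃ : inner ℝ (n x) X = (inner ℝ (n x) Y : ℝ)) : X = Y := by
  refine eq_of_inner_orthonormal (h.inner_left x hx) (h.inner_right x hx)
    (h.inner_normal_normal x hx) (h.inner_left_right x hx) ?_ ?_ h₁ h₂ h₃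
  · rw [real_inner_comm]; exact h.inner_normal_left x hx
  · rw [real_inner_comm]; exact h.inner_normal_right x hx

/-- The three coordinates in the frame come from differentiating `⟨E₁, E₁⟩ = 1` and `⟨n, E₁⟩ = 0`,
where `E₁ = dirDeriv e₁ ψ`, and from the definition of `conn`. -/
theorem dirDeriv_left_left (h : PrincipalFrame ψ n H s e₁ e₂ U) {x : EuclideanSpace ℝ (Fin 2)}
    (hx : x ∈ U) : dirDeriv e₁ (dirDeriv e₁ ψ) x
      = conn ψ e₁ e₂ x • dirDeriv e₂ ψ x + (H + s x) • n x := by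
  have hE := h.smooth_dirDeriv_left.differentiableAt_of_isOpen h.isOpen hx
  have hn := h.smooth_normal.differentiableAt_of_isOpen h.isOpen hx
  have i₁ := dirDeriv_inner (e := e₁) hE hE
  have i₂ := dirDeriv_inner (e := e₁) hn hE
  rw [dirDeriv_congr h.isOpen h.inner_left hx, dirDeriv_const] at i₁
  rw [dirDeriv_congr h.isOpen h.inner_normal_left hx, dirDeriv_const,
    h.dirDeriv_left_normal x hx, inner_neg_left, inner_smul_left, h.inner_left x hx] at i₂
  have c₁ : inner ℝ (dirDeriv e₁ ψ x) (n x) = (0 : ℝ) := by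
    rw [real_inner_comm]; exact h.inner_normal_left x hx
  have c₂ : inner ℝ (dirDeriv e₂ ψ x) (n x) = (0 : ℝ) := by
    rw [real_inner_comm]; exact h.inner_normal_right x hx
  have i₃ := real_inner_comm (dirDeriv e₁ ψ x) (dirDeriv e₁ (dirDeriv e₁ ψ) x)
  simp only [conj_trivial] at i₂
  apply h.ext_inner hx
  · simp only [inner_add_right, inner_smul_right, h.inner_left_right x hx, c₁]
    linarith
  · simp only [inner_add_right, inner_smul_right, h.inner_right x hx, c₂, conn]
    rw [real_inner_comm]; ring
  · simp only [inner_add_right, inner_smul_right, h.inner_normal_right x hx,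
      h.inner_normal_normal x hx]
    linarith

theorem dirDeriv_left_right (h : PrincipalFrame ψ n H s e₁ e₂ U) {x : EuclideanSpace ℝ (Fin 2)}
    (hx : x ∈ U) : dirDeriv e₁ (dirDeriv e₂ ψ) x = -(conn ψ e₁ e₂ x • dirDeriv e₁ ψ x) := by
  have hE := h.smooth_dirDeriv_left.differentiableAt_of_isOpen h.isOpen hx
  have hE' := h.swap.smooth_dirDeriv_left.differentiableAt_of_isOpen h.isOpen hx
  have hn := h.smooth_normal.differentiableAt_of_isOpen h.isOpen hx
  have i₀ := dirDeriv_inner (e := e₁) hE hE'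
  have i₁ := dirDeriv_inner (e := e₁) hE' hE'
  have i₂ := dirDeriv_inner (e := e₁) hn hE'
  rw [dirDeriv_congr h.isOpen h.inner_left_right hx, dirDeriv_const] at i₀
  rw [dirDeriv_congr h.isOpen h.inner_right hx, dirDeriv_const] at i₁
  rw [dirDeriv_congr h.isOpen h.inner_normal_right hx, dirDeriv_const,
    h.dirDeriv_left_normal x hx, inner_neg_left, inner_smul_left, h.inner_left_right x hx] at i₂
  have i₃ := real_inner_comm (dirDeriv e₂ ψ x) (dirDeriv e₁ (dirDeriv e₂ ψ) x)
  have c₁ : inner ℝ (dirDeriv e₂ ψ x) (dirDeriv e₁ ψ x) = (0 : ℝ) := by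
    rw [real_inner_comm]; exact h.inner_left_right x hx
  apply h.ext_inner hx
  · simp only [inner_neg_right, inner_smul_right, h.inner_left x hx, conn]
    linarith
  · simp only [inner_neg_right, inner_smul_right, c₁]
    linarith
  · simp only [inner_neg_right, inner_smul_right, h.inner_normal_left x hx]
    linarith

theorem dirDeriv_right_right (h : PrincipalFrame ψ n H s e₁ e₂ U)
    {x : EuclideanSpace ℝ (Fin 2)} (hx : x ∈ U) : dirDeriv e₂ (dirDeriv e₂ ψ) x
      = conn ψ e₂ e₁ x • dirDeriv e₁ ψ x + (H - s x) • n x :=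
  h.swap.dirDeriv_left_left hx

theorem dirDeriv_right_left (h : PrincipalFrame ψ n H s e₁ e₂ U) {x : EuclideanSpace ℝ (Fin 2)}
    (hx : x ∈ U) : dirDeriv e₂ (dirDeriv e₁ ψ) x = -(conn ψ e₂ e₁ x • dirDeriv e₂ ψ x) :=
  h.swap.dirDeriv_left_right hx

/-- The bracket is `[e₁, e₂] = -a e₁ + b e₂`: its image under the injective `dψ` is read off from
the structure equations. -/
theorem dirDeriv_comm {F : Type*} [NormedAddCommGroup F] [NormedSpace ℝ F]
    (h : PrincipalFrame ψ n H s e₁ e₂ U) {f : EuclideanSpace ℝ (Fin 2) → F}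
    (hf : ContDiffOn ℝ ∞ f U) {x : EuclideanSpace ℝ (Fin 2)} (hx : x ∈ U) :
    dirDeriv e₁ (dirDeriv e₂ f) x - dirDeriv e₂ (dirDeriv e₁ f) x
      = -(conn ψ e₁ e₂ x • dirDeriv e₁ f x) + conn ψ e₂ e₁ x • dirDeriv e₂ f x := by
  have hb : dirDeriv e₁ e₂ x - dirDeriv e₂ e₁ x
      = -(conn ψ e₁ e₂ x • e₁ x) + conn ψ e₂ e₁ x • e₂ x := by
    apply h.injective x hx
    rw [← dirDeriv_dirDeriv_sub h.isOpen h.smooth_param h.smooth_left h.smooth_right hx,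
      h.dirDeriv_left_right hx, h.dirDeriv_right_left hx]
    simp [dirDeriv]
  rw [dirDeriv_dirDeriv_sub h.isOpen hf h.smooth_left h.smooth_right hx, hb]
  simp [dirDeriv]

theorem differentiableAt_s (h : PrincipalFrame ψ n H s e₁ e₂ U) {x : EuclideanSpace ℝ (Fin 2)}
    (hx : x ∈ U) : DifferentiableAt ℝ s x :=
  h.smooth_s.differentiableAt_of_isOpen h.isOpen hx

/-- The Codazzi equation: the commutator formula applied to `n`, in its `e₁` component. Constancy of
`H` leaves only the derivative of `s`. -/
theorem dirDeriv_right_s (h : PrincipalFrame ψ n H s e₁ e₂ U) {x : EuclideanSpace ℝ (Fin 2)}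
    (hx : x ∈ U) : dirDeriv e₂ s x = 2 * s x * conn ψ e₁ e₂ x := by
  have hs := h.differentiableAt_s hx
  have hE := h.smooth_dirDeriv_left.differentiableAt_of_isOpen h.isOpen hx
  have hE' := h.swap.smooth_dirDeriv_left.differentiableAt_of_isOpen h.isOpen hx
  have key := h.dirDeriv_comm h.smooth_normal hx
  rw [dirDeriv_congr h.isOpen h.dirDeriv_left_normal hx,
    dirDeriv_congr h.isOpen h.dirDeriv_right_normal hx, dirDeriv_neg, dirDeriv_neg,
    dirDeriv_smul (by fun_prop) hE, dirDeriv_smul (by fun_prop) hE', h.dirDeriv_left_right hx,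
    h.dirDeriv_right_left hx, h.dirDeriv_left_normal x hx, h.dirDeriv_right_normal x hx,
    dirDeriv_add (by fun_prop) hs, dirDeriv_const] at key
  have k := congrArg (fun v => (inner ℝ (dirDeriv e₁ ψ x) v : ℝ)) key
  simp only [inner_add_right, inner_sub_right, inner_neg_right, inner_smul_right,
    h.inner_left x hx, h.inner_left_right x hx] at k
  linarith

theorem dirDeriv_left_s (h : PrincipalFrame ψ n H s e₁ e₂ U) {x : EuclideanSpace ℝ (Fin 2)}
    (hx : x ∈ U) : dirDeriv e₁ s x = 2 * s x * conn ψ e₂ e₁ x := by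
  have := h.swap.dirDeriv_right_s hx
  rw [dirDeriv_neg] at this
  linarith

/-- The commutator formula applied to `dirDeriv e₁ ψ`, in its `e₂` component; the normal terms
contribute `(H + s)(H - s)`. -/
theorem gauss_equation (h : PrincipalFrame ψ n H s e₁ e₂ U) {x : EuclideanSpace ℝ (Fin 2)}
    (hx : x ∈ U) : dirDeriv e₁ (conn ψ e₂ e₁) x + dirDeriv e₂ (conn ψ e₁ e₂) x
      = H ^ 2 - s x ^ 2 + conn ψ e₁ e₂ x ^ 2 + conn ψ e₂ e₁ x ^ 2 := by
  have hs := h.differentiableAt_s hx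
  have hn := h.smooth_normal.differentiableAt_of_isOpen h.isOpen hx
  have hE' := h.swap.smooth_dirDeriv_left.differentiableAt_of_isOpen h.isOpen hx
  have ha := h.smooth_conn.differentiableAt_of_isOpen h.isOpen hx
  have hb := h.swap.smooth_conn.differentiableAt_of_isOpen h.isOpen hx
  have key := h.dirDeriv_comm h.smooth_dirDeriv_left hx
  rw [dirDeriv_congr h.isOpen (fun y hy => h.dirDeriv_right_left hy) hx,
    dirDeriv_congr h.isOpen (fun y hy => h.dirDeriv_left_left hy) hx, dirDeriv_neg,
    dirDeriv_smul hb hE', dirDeriv_add (by fun_prop) (by fun_prop),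
    dirDeriv_smul ha hE', dirDeriv_smul (by fun_prop) hn, h.dirDeriv_left_right hx,
    h.dirDeriv_left_left hx, h.dirDeriv_right_right hx, h.dirDeriv_right_left hx,
    h.dirDeriv_right_normal x hx] at key
  have k := congrArg (fun v => (inner ℝ (dirDeriv e₂ ψ x) v : ℝ)) key
  have c₁ : inner ℝ (dirDeriv e₂ ψ x) (dirDeriv e₁ ψ x) = (0 : ℝ) := by
    rw [real_inner_comm]; exact h.inner_left_right x hx
  have c₂ : inner ℝ (dirDeriv e₂ ψ x) (n x) = (0 : ℝ) := by
    rw [real_inner_comm]; exact h.inner_normal_right x hx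
  simp only [inner_add_right, inner_sub_right, inner_neg_right, inner_smul_right,
    h.inner_right x hx, c₁, c₂] at k
  linarith

end PrincipalFrame

/-! ### Constant mean curvature shrinkers are flat away from umbilics. -/

/-- The polynomial in the half difference `t` of the principal curvatures which vanishes on a
shrinker of constant mean curvature wherever `t` varies along the first principal direction. -/
def cmcShrinkerPoly (α lam H t : ℝ) : ℝ :=
  -4 * H * (α * H + (H ^ 2 - t ^ 2 - lam) * (H ^ 2 + t ^ 2) - 2 * t ^ 2 * (H ^ 2 - t ^ 2))
    + 4 * (H + t) ^ 2 * (α + (H + t) * (H ^ 2 - t ^ 2 - lam))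
    - 2 * t * (H + t) * (4 * t ^ 3 - 2 * (lam + 2 * H ^ 2) * t)

/-- The polynomial has leading term `-12 t⁵` whatever the parameters, so it is never zero. -/
theorem finite_cmcShrinkerPoly_eq_zero (α lam H : ℝ) :
    {t : ℝ | cmcShrinkerPoly α lam H t = 0}.Finite := by
  open Polynomial in
  let p : ℝ[X] :=
    -4 * C H * (C α * C H + (C H ^ 2 - X ^ 2 - C lam) * (C H ^ 2 + X ^ 2)
        - 2 * X ^ 2 * (C H ^ 2 - X ^ 2))
      + 4 * (C H + X) ^ 2 * (C α + (C H + X) * (C H ^ 2 - X ^ 2 - C lam))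
      - 2 * X * (C H + X) * (4 * X ^ 3 - 2 * (C lam + 2 * C H ^ 2) * X)
  have hp : ∀ t, p.eval t = cmcShrinkerPoly α lam H t := by
    intro t
    simp [p, cmcShrinkerPoly]
  have hne : p ≠ 0 := by
    intro h0
    have hz : ∀ t, cmcShrinkerPoly α lam H t = 0 := fun t => by rw [← hp, h0]; simp
    -- The fifth finite difference of the values at `0, …, 5` is `5! · (-12)`, which is incompatible
    -- with all six being zero.
    have h₀ := hz 0
    have h₁ := hz 1
    have h₂ := hz 2
    have h₃ := hz 3
    have h₄ := hz 4
    have h₅ := hz 5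
    unfold cmcShrinkerPoly at h₀ h₁ h₂ h₃ h₄ h₅
    ring_nf at h₀ h₁ h₂ h₃ h₄ h₅
    linarith
  refine (p.rootSet_finite ℝ).subset fun t ht => ?_
  rw [Polynomial.mem_rootSet]
  exact ⟨hne, by simpa [hp] using ht⟩

/-- By continuity `s` avoids the finite, hence closed, set `T \ {s x}` near `x`, so it is locally
constant. -/
theorem dirDeriv_eq_zero_of_eventually_mem_finite {V : Type*} [NormedAddCommGroup V]
    [NormedSpace ℝ V] {s : V → ℝ} {x : V} {T : Set ℝ} (hT : T.Finite) (hs : ContinuousAt s x)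
    (h : ∀ᶠ y in nhds x, s y ∈ T) (e : V → V) : dirDeriv e s x = 0 := by
  have hcl : IsClosed (T \ {s x}) := (hT.subset Set.sdiff_subset).isClosed
  have h' : ∀ᶠ y in nhds x, s y ∈ (T \ {s x})ᶜ :=
    hs.eventually (hcl.isOpen_compl.mem_nhds (by simp))
  have hc : s =ᶠ[nhds x] fun _ => s x := by
    filter_upwards [h, h'] with y hy hy'
    by_contra hne
    exact hy' ⟨hy, hne⟩
  simp [dirDeriv, hc.fderiv_eq]

theorem linearIndependent_of_orthonormal_image {V : Type*} [AddCommGroup V] [Module ℝ V]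
    (T : V →ₗ[ℝ] E3) {v w : V} (hv : inner ℝ (T v) (T v) = (1 : ℝ))
    (hw : inner ℝ (T w) (T w) = (1 : ℝ)) (hvw : inner ℝ (T v) (T w) = (0 : ℝ)) :
    LinearIndependent ℝ ![v, w] := by
  rw [LinearIndependent.pair_iff]
  intro p q hpq
  have h0 := congrArg T hpq
  simp only [map_add, map_smul, map_zero] at h0
  have i₁ := congrArg (fun y => (inner ℝ (T v) y : ℝ)) h0
  have i₂ := congrArg (fun y => (inner ℝ y (T w) : ℝ)) h0
  simp only [inner_add_right, inner_add_left, inner_smul_right, inner_smul_left,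
    inner_zero_left, inner_zero_right, conj_trivial, hv, hw, hvw] at i₁ i₂
  constructor <;> linarith

theorem span_pair_eq_top_of_orthonormal_image {V : Type*} [AddCommGroup V] [Module ℝ V]
    (T : V →ₗ[ℝ] E3) (hV : Module.finrank ℝ V = 2) {v w : V}
    (hv : inner ℝ (T v) (T v) = (1 : ℝ)) (hw : inner ℝ (T w) (T w) = (1 : ℝ))
    (hvw : inner ℝ (T v) (T w) = (0 : ℝ)) : Submodule.span ℝ (Set.range ![v, w]) = ⊤ :=
  have : FiniteDimensional ℝ V := Module.finite_of_finrank_eq_succ hV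
  (linearIndependent_of_orthonormal_image T hv hw hvw).span_eq_top_of_card_eq_finrank'
    (by simp [hV])

namespace PrincipalFrame

variable {ψ n : EuclideanSpace ℝ (Fin 2) → E3} {H : ℝ} {s : EuclideanSpace ℝ (Fin 2) → ℝ}
  {e₁ e₂ : EuclideanSpace ℝ (Fin 2) → EuclideanSpace ℝ (Fin 2)}
  {U : Set (EuclideanSpace ℝ (Fin 2))} {α lam : ℝ}

/-- The component of the position vector along the vector field `e`. -/
def posComp (ψ : EuclideanSpace ℝ (Fin 2) → E3)
    (e : EuclideanSpace ℝ (Fin 2) → EuclideanSpace ℝ (Fin 2))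
    (x : EuclideanSpace ℝ (Fin 2)) : ℝ :=
  inner ℝ (ψ x) (dirDeriv e ψ x)

theorem smooth_posComp (h : PrincipalFrame ψ n H s e₁ e₂ U) : ContDiffOn ℝ ∞ (posComp ψ e₁) U :=
  h.smooth_param.inner ℝ h.smooth_dirDeriv_left

theorem dirDeriv_left_posComp_left (h : PrincipalFrame ψ n H s e₁ e₂ U)
    {x : EuclideanSpace ℝ (Fin 2)} (hx : x ∈ U) : dirDeriv e₁ (posComp ψ e₁) x
      = 1 + conn ψ e₁ e₂ x * posComp ψ e₂ x + (H + s x) * inner ℝ (n x) (ψ x) := by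
  have hE := h.smooth_dirDeriv_left.differentiableAt_of_isOpen h.isOpen hx
  have hψ := h.smooth_param.differentiableAt_of_isOpen h.isOpen hx
  have : dirDeriv e₁ (posComp ψ e₁) x = _ := dirDeriv_inner hψ hE
  rw [h.dirDeriv_left_left hx, inner_add_right, inner_smul_right, inner_smul_right,
    h.inner_left x hx, real_inner_comm (n x)] at this
  simp only [posComp] at this ⊢
  linarith

theorem dirDeriv_left_posComp_right (h : PrincipalFrame ψ n H s e₁ e₂ U)
    {x : EuclideanSpace ℝ (Fin 2)} (hx : x ∈ U) : dirDeriv e₁ (posComp ψ e₂) x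
      = -(conn ψ e₁ e₂ x * posComp ψ e₁ x) := by
  have hE := h.swap.smooth_dirDeriv_left.differentiableAt_of_isOpen h.isOpen hx
  have hψ := h.smooth_param.differentiableAt_of_isOpen h.isOpen hx
  have : dirDeriv e₁ (posComp ψ e₂) x = _ := dirDeriv_inner hψ hE
  rw [h.dirDeriv_left_right hx, inner_neg_right, inner_smul_right, h.inner_left_right x hx] at this
  simp only [posComp] at this ⊢
  linarith

/-- The shrinker equation differentiated along `e₁`: Codazzi handles `e₁ s`, and Weingarten turns
`e₁⟨n, ψ⟩` into `-(H + s)⟨ψ, e₁⟩`. -/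
theorem four_mul_sq_mul_conn_right (h : PrincipalFrame ψ n H s e₁ e₂ U)
    (hK : ∀ x ∈ U, H ^ 2 - s x ^ 2 = α * inner ℝ (n x) (ψ x) + lam)
    {x : EuclideanSpace ℝ (Fin 2)} (hx : x ∈ U) :
    4 * s x ^ 2 * conn ψ e₂ e₁ x = α * (H + s x) * posComp ψ e₁ x := by
  have hs := h.differentiableAt_s hx
  have hn := h.smooth_normal.differentiableAt_of_isOpen h.isOpen hx
  have hψ := h.smooth_param.differentiableAt_of_isOpen h.isOpen hx
  have hu := dirDeriv_inner (e := e₁) hn hψ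
  have hin : DifferentiableAt ℝ (fun y => (inner ℝ (n y) (ψ y) : ℝ)) x := hn.inner ℝ hψ
  have h0 : ∀ y ∈ U, s y * s y + α * inner ℝ (n y) (ψ y) = H ^ 2 - lam := by
    intro y hy
    linarith [hK y hy]
  have h1 := dirDeriv_congr (e := e₁) h.isOpen h0 hx
  rw [dirDeriv_const, dirDeriv_add (hs.fun_mul hs) (hin.const_mul α), dirDeriv_mul hs hs,
    dirDeriv_mul (by fun_prop) hin, hu, dirDeriv_const, h.dirDeriv_left_normal x hx,
    h.dirDeriv_left_s hx, inner_neg_left, inner_smul_left, h.inner_normal_left x hx,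
    real_inner_comm] at h1
  simp only [posComp, conj_trivial] at h1 ⊢
  linarith

theorem four_mul_sq_mul_conn_left (h : PrincipalFrame ψ n H s e₁ e₂ U)
    (hK : ∀ x ∈ U, H ^ 2 - s x ^ 2 = α * inner ℝ (n x) (ψ x) + lam)
    {x : EuclideanSpace ℝ (Fin 2)} (hx : x ∈ U) :
    4 * s x ^ 2 * conn ψ e₁ e₂ x = α * (H - s x) * posComp ψ e₂ x := by
  have := h.swap.four_mul_sq_mul_conn_right (by simpa using hK) hx
  simpa [sub_eq_add_neg] using this

theorem dirDeriv_left_conn_right (h : PrincipalFrame ψ n H s e₁ e₂ U)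
    (hK : ∀ x ∈ U, H ^ 2 - s x ^ 2 = α * inner ℝ (n x) (ψ x) + lam)
    {x : EuclideanSpace ℝ (Fin 2)} (hx : x ∈ U) :
    4 * s x ^ 2 * dirDeriv e₁ (conn ψ e₂ e₁) x
      = -16 * s x ^ 2 * conn ψ e₂ e₁ x ^ 2 + 2 * α * s x * conn ψ e₂ e₁ x * posComp ψ e₁ x
        + α * (H + s x) * (1 + conn ψ e₁ e₂ x * posComp ψ e₂ x
          + (H + s x) * inner ℝ (n x) (ψ x)) := by
  have hs := h.differentiableAt_s hx
  have hb := h.swap.smooth_conn.differentiableAt_of_isOpen h.isOpen hx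
  have hp := h.smooth_posComp.differentiableAt_of_isOpen h.isOpen hx
  have h0 : ∀ y ∈ U, s y * (s y * conn ψ e₂ e₁ y) = α / 4 * ((H + s y) * posComp ψ e₁ y) := by
    intro y hy
    linarith [h.four_mul_sq_mul_conn_right hK hy]
  have h1 := dirDeriv_congr (e := e₁) h.isOpen h0 hx
  rw [dirDeriv_mul hs (hs.fun_mul hb), dirDeriv_mul hs hb,
    dirDeriv_mul (by fun_prop) (by fun_prop), dirDeriv_mul (by fun_prop) hp,
    dirDeriv_add (by fun_prop) hs, dirDeriv_const, dirDeriv_const, h.dirDeriv_left_s hx,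
    h.dirDeriv_left_posComp_left hx] at h1
  linear_combination 4 * h1

/-- This derivative does not occur in the Gauss equation; it is needed to differentiate `a² + b²`
along `e₁`. -/
theorem dirDeriv_left_conn_left (h : PrincipalFrame ψ n H s e₁ e₂ U)
    (hK : ∀ x ∈ U, H ^ 2 - s x ^ 2 = α * inner ℝ (n x) (ψ x) + lam)
    {x : EuclideanSpace ℝ (Fin 2)} (hx : x ∈ U) :
    4 * s x ^ 2 * dirDeriv e₁ (conn ψ e₁ e₂) x
      = -16 * s x ^ 2 * conn ψ e₁ e₂ x * conn ψ e₂ e₁ x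
        - 2 * α * s x * conn ψ e₂ e₁ x * posComp ψ e₂ x
        - α * (H - s x) * (conn ψ e₁ e₂ x * posComp ψ e₁ x) := by
  have hs := h.differentiableAt_s hx
  have ha := h.smooth_conn.differentiableAt_of_isOpen h.isOpen hx
  have hp := h.swap.smooth_posComp.differentiableAt_of_isOpen h.isOpen hx
  have h0 : ∀ y ∈ U, s y * (s y * conn ψ e₁ e₂ y) = α / 4 * ((H + -s y) * posComp ψ e₂ y) := by
    intro y hy
    linarith [h.four_mul_sq_mul_conn_left hK hy]
  have h1 := dirDeriv_congr (e := e₁) h.isOpen h0 hx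
  rw [dirDeriv_mul hs (hs.fun_mul ha), dirDeriv_mul hs ha,
    dirDeriv_mul (by fun_prop) (by fun_prop), dirDeriv_mul (by fun_prop) hp,
    dirDeriv_add (by fun_prop) (by fun_prop), dirDeriv_neg, dirDeriv_const, dirDeriv_const,
    h.dirDeriv_left_s hx, h.dirDeriv_left_posComp_right hx] at h1
  linear_combination 4 * h1

theorem dirDeriv_right_conn_left (h : PrincipalFrame ψ n H s e₁ e₂ U)
    (hK : ∀ x ∈ U, H ^ 2 - s x ^ 2 = α * inner ℝ (n x) (ψ x) + lam)
    {x : EuclideanSpace ℝ (Fin 2)} (hx : x ∈ U) :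
    4 * s x ^ 2 * dirDeriv e₂ (conn ψ e₁ e₂) x
      = -16 * s x ^ 2 * conn ψ e₁ e₂ x ^ 2 - 2 * α * s x * conn ψ e₁ e₂ x * posComp ψ e₂ x
        + α * (H - s x) * (1 + conn ψ e₂ e₁ x * posComp ψ e₁ x
          + (H - s x) * inner ℝ (n x) (ψ x)) := by
  have := h.swap.dirDeriv_left_conn_right (by simpa using hK) hx
  linear_combination this

/-- The Gauss equation times `2s²`, with the derivatives of `a` and `b` taken from the twice
differentiated shrinker equation. The first-order relations remove the position components, and the
shrinker equation removes `⟨n, ψ⟩`. -/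
theorem eight_mul_sq_mul_conn_sq (h : PrincipalFrame ψ n H s e₁ e₂ U)
    (hK : ∀ x ∈ U, H ^ 2 - s x ^ 2 = α * inner ℝ (n x) (ψ x) + lam)
    {x : EuclideanSpace ℝ (Fin 2)} (hx : x ∈ U) :
    8 * s x ^ 2 * (conn ψ e₁ e₂ x ^ 2 + conn ψ e₂ e₁ x ^ 2)
      = α * H + (H ^ 2 - s x ^ 2 - lam) * (H ^ 2 + s x ^ 2)
        - 2 * s x ^ 2 * (H ^ 2 - s x ^ 2) := by
  have g := h.gauss_equation hx
  have g₁ := h.dirDeriv_left_conn_right hK hx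
  have g₂ := h.dirDeriv_right_conn_left hK hx
  have c₁ := h.four_mul_sq_mul_conn_left hK hx
  have c₂ := h.four_mul_sq_mul_conn_right hK hx
  have k := hK x hx
  linear_combination (-2 * s x ^ 2) * g + (1 / 2) * g₁ + (1 / 2) * g₂
    - (1 / 2) * conn ψ e₁ e₂ x * c₁ - (1 / 2) * conn ψ e₂ e₁ x * c₂ - (H ^ 2 + s x ^ 2) * k

/-- Comes from differentiating `eight_mul_sq_mul_conn_sq` along `e₁`; every surviving term carries a
factor `b`. -/
theorem conn_right_mul_poly (h : PrincipalFrame ψ n H s e₁ e₂ U)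
    (hK : ∀ x ∈ U, H ^ 2 - s x ^ 2 = α * inner ℝ (n x) (ψ x) + lam)
    {x : EuclideanSpace ℝ (Fin 2)} (hx : x ∈ U) :
    conn ψ e₂ e₁ x * cmcShrinkerPoly α lam H (s x) = 0 := by
  have hs := h.differentiableAt_s hx
  have ha := h.smooth_conn.differentiableAt_of_isOpen h.isOpen hx
  have hb := h.swap.smooth_conn.differentiableAt_of_isOpen h.isOpen hx
  have e₀ := h.eight_mul_sq_mul_conn_sq hK hx
  have h0 : ∀ y ∈ U, s y * s y * (conn ψ e₁ e₂ y * conn ψ e₁ e₂ y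
      + conn ψ e₂ e₁ y * conn ψ e₂ e₁ y)
      = (fun t : ℝ => (t ^ 4 - (lam + 2 * H ^ 2) * t ^ 2 + (α * H + H ^ 4 - lam * H ^ 2)) / 8)
        (s y) := by
    intro y hy
    linear_combination (1 / 8) * h.eight_mul_sq_mul_conn_sq hK hy
  have hg : HasDerivAt
      (fun t : ℝ => (t ^ 4 - (lam + 2 * H ^ 2) * t ^ 2 + (α * H + H ^ 4 - lam * H ^ 2)) / 8)
      ((4 * s x ^ 3 - (lam + 2 * H ^ 2) * (2 * s x)) / 8) (s x) := by
    refine ((((hasDerivAt_pow 4 (s x)).fun_sub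
      ((hasDerivAt_pow 2 (s x)).const_mul (lam + 2 * H ^ 2))).add_const
        (α * H + H ^ 4 - lam * H ^ 2)).div_const 8).congr_deriv ?_
    norm_num
  have h1 := dirDeriv_congr (e := e₁) h.isOpen h0 hx
  rw [dirDeriv_comp hg hs, dirDeriv_mul (hs.fun_mul hs) ((ha.fun_mul ha).fun_add (hb.fun_mul hb)),
    dirDeriv_mul hs hs, dirDeriv_add (ha.fun_mul ha) (hb.fun_mul hb), dirDeriv_mul ha ha,
    dirDeriv_mul hb hb, h.dirDeriv_left_s hx] at h1
  have g₁ := h.dirDeriv_left_conn_right hK hx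
  have g₂ := h.dirDeriv_left_conn_left hK hx
  have c₁ := h.four_mul_sq_mul_conn_left hK hx
  have c₂ := h.four_mul_sq_mul_conn_right hK hx
  have k := hK x hx
  unfold cmcShrinkerPoly
  set a := conn ψ e₁ e₂ x
  set b := conn ψ e₂ e₁ x
  set S := s x
  set x₁ := posComp ψ e₁ x
  set x₂ := posComp ψ e₂ x
  set u : ℝ := inner ℝ (n x) (ψ x)
  -- The factor `H + S` lets `α(H + S)x₁` be replaced by `4S²b`. After this and the analogous
  -- replacement of `α(H - S)x₂`, both `a²` and `b²` have coefficient `-32HS²b`, so only `a² + b²`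
  -- remains and `e₀` makes it a polynomial in `S`.
  have key : (H + S) * (-32 * S ^ 2 * b * (a ^ 2 + b ^ 2))
      + (H + S) * (4 * α * a * b * x₂ * (H - S))
      + (H + S) * (4 * α * x₁ * (2 * S * b ^ 2 - (H - S) * a ^ 2))
      + 4 * α * b * (H + S) ^ 2 * (1 + (H + S) * u)
      = 2 * S * b * (H + S) * (4 * S ^ 3 - (lam + 2 * H ^ 2) * (2 * S)) := by
    linear_combination (H + S) * (8 * h1 - 4 * b * g₁ - 4 * a * g₂)
  linear_combination key + 4 * (H + S) * a * b * c₁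
    + 4 * (2 * S * b ^ 2 - (H - S) * a ^ 2) * c₂ + 4 * H * b * e₀ + 4 * b * (H + S) ^ 3 * k

/-- If `b ≠ 0` at a point, then nearby `s` is a root of a fixed nonzero polynomial, hence locally
constant, against `e₁ s = 2sb` with `s ≠ 0`. -/
theorem conn_right_eq_zero (h : PrincipalFrame ψ n H s e₁ e₂ U)
    (hK : ∀ x ∈ U, H ^ 2 - s x ^ 2 = α * inner ℝ (n x) (ψ x) + lam)
    {x : EuclideanSpace ℝ (Fin 2)} (hx : x ∈ U) : conn ψ e₂ e₁ x = 0 := by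
  by_contra hne
  have hb := (h.swap.smooth_conn.differentiableAt_of_isOpen h.isOpen hx).continuousAt
  have hev : ∀ᶠ y in nhds x, s y ∈ {t : ℝ | cmcShrinkerPoly α lam H t = 0} := by
    filter_upwards [hb.eventually_ne hne, h.isOpen.mem_nhds hx] with y hy hyU
    exact (mul_eq_zero.mp (h.conn_right_mul_poly hK hyU)).resolve_left hy
  have h0 := dirDeriv_eq_zero_of_eventually_mem_finite (finite_cmcShrinkerPoly_eq_zero α lam H)
    (h.differentiableAt_s hx).continuousAt hev e₁
  rw [h.dirDeriv_left_s hx] at h0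
  have := h.s_ne_zero x hx
  simp_all

theorem conn_left_eq_zero (h : PrincipalFrame ψ n H s e₁ e₂ U)
    (hK : ∀ x ∈ U, H ^ 2 - s x ^ 2 = α * inner ℝ (n x) (ψ x) + lam)
    {x : EuclideanSpace ℝ (Fin 2)} (hx : x ∈ U) : conn ψ e₁ e₂ x = 0 :=
  h.swap.conn_right_eq_zero (by simpa using hK) hx

/-- A shrinker of constant mean curvature is flat away from its umbilics. -/
theorem sq_eq_sq (h : PrincipalFrame ψ n H s e₁ e₂ U)
    (hK : ∀ x ∈ U, H ^ 2 - s x ^ 2 = α * inner ℝ (n x) (ψ x) + lam)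
    {x : EuclideanSpace ℝ (Fin 2)} (hx : x ∈ U) : s x ^ 2 = H ^ 2 := by
  have g := h.gauss_equation hx
  rw [dirDeriv_congr h.isOpen (fun y hy => h.conn_right_eq_zero hK hy) hx,
    dirDeriv_congr h.isOpen (fun y hy => h.conn_left_eq_zero hK hy) hx, dirDeriv_const,
    dirDeriv_const, h.conn_right_eq_zero hK hx, h.conn_left_eq_zero hK hx] at g
  linarith

/-- On a shrinker of constant mean curvature, the direction of the vanishing principal curvature
is parallel in `ℝ³`. -/
theorem fderiv_dirDeriv_right_eq_zero (h : PrincipalFrame ψ n H s e₁ e₂ U)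
    (hK : ∀ x ∈ U, H ^ 2 - s x ^ 2 = α * inner ℝ (n x) (ψ x) + lam)
    {x : EuclideanSpace ℝ (Fin 2)} (hx : x ∈ U) (hs : s x = H) :
    fderiv ℝ (dirDeriv e₂ ψ) x = 0 := by
  have d₁ := h.dirDeriv_left_right hx
  have d₂ := h.dirDeriv_right_right hx
  rw [h.conn_left_eq_zero hK hx] at d₁
  rw [h.conn_right_eq_zero hK hx, hs] at d₂
  simp only [zero_smul, neg_zero, sub_self, add_zero] at d₁ d₂
  have hb := span_pair_eq_top_of_orthonormal_image (fderiv ℝ ψ x).toLinearMap (by simp)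
    (h.inner_left x hx) (h.inner_right x hx) (h.inner_left_right x hx)
  apply ContinuousLinearMap.coe_injective
  refine LinearMap.ext_on hb ?_
  rintro _ ⟨i, rfl⟩
  fin_cases i
  · simpa [dirDeriv] using d₁
  · simpa [dirDeriv] using d₂

end PrincipalFrame

/-! ### Construction of smooth principal frames away from umbilics. -/

/-- A smooth parametrized surface `ψ` with smooth unit normal `n` over the open set `U`. -/
structure ParamSurface (ψ n : EuclideanSpace ℝ (Fin 2) → E3)
    (U : Set (EuclideanSpace ℝ (Fin 2))) : Prop where
  isOpen : IsOpen U
  smooth_param : ContDiffOn ℝ ∞ ψ U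
  smooth_normal : ContDiffOn ℝ ∞ n U
  injective : ∀ x ∈ U, Function.Injective (fderiv ℝ ψ x)
  inner_normal_normal : ∀ x ∈ U, inner ℝ (n x) (n x) = (1 : ℝ)
  inner_normal : ∀ x ∈ U, ∀ v, inner ℝ (n x) (fderiv ℝ ψ x v) = (0 : ℝ)

/-- A smooth orthonormal tangent frame `f₁`, `f₂` in which the second fundamental form of the
parametrized surface is `!![H + A, B; B, H - A]`. -/
structure ShapeFrame (ψ n : EuclideanSpace ℝ (Fin 2) → E3) (H : ℝ)
    (A B : EuclideanSpace ℝ (Fin 2) → ℝ)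
    (f₁ f₂ : EuclideanSpace ℝ (Fin 2) → EuclideanSpace ℝ (Fin 2))
    (U : Set (EuclideanSpace ℝ (Fin 2))) : Prop where
  smooth_diag : ContDiffOn ℝ ∞ A U
  smooth_offDiag : ContDiffOn ℝ ∞ B U
  smooth_left : ContDiffOn ℝ ∞ f₁ U
  smooth_right : ContDiffOn ℝ ∞ f₂ U
  inner_left : ∀ x ∈ U, inner ℝ (dirDeriv f₁ ψ x) (dirDeriv f₁ ψ x) = (1 : ℝ)
  inner_right : ∀ x ∈ U, inner ℝ (dirDeriv f₂ ψ x) (dirDeriv f₂ ψ x) = (1 : ℝ)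
  inner_left_right : ∀ x ∈ U, inner ℝ (dirDeriv f₁ ψ x) (dirDeriv f₂ ψ x) = (0 : ℝ)
  dirDeriv_left_normal : ∀ x ∈ U,
    dirDeriv f₁ n x = -((H + A x) • dirDeriv f₁ ψ x + B x • dirDeriv f₂ ψ x)
  dirDeriv_right_normal : ∀ x ∈ U,
    dirDeriv f₂ n x = -(B x • dirDeriv f₁ ψ x + (H - A x) • dirDeriv f₂ ψ x)

/-- `H` and `K` are the mean and Gauss curvatures of the parametrized surface, as computed in any
orthonormal tangent basis. -/
def HasCurvatures (ψ n : EuclideanSpace ℝ (Fin 2) → E3) (H : ℝ)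
    (K : EuclideanSpace ℝ (Fin 2) → ℝ) (U : Set (EuclideanSpace ℝ (Fin 2))) : Prop :=
  ∀ x ∈ U, ∀ v w : EuclideanSpace ℝ (Fin 2), ∀ a b c d : ℝ,
    inner ℝ (fderiv ℝ ψ x v) (fderiv ℝ ψ x v) = (1 : ℝ) →
    inner ℝ (fderiv ℝ ψ x w) (fderiv ℝ ψ x w) = (1 : ℝ) →
    inner ℝ (fderiv ℝ ψ x v) (fderiv ℝ ψ x w) = (0 : ℝ) →
    fderiv ℝ n x v = -(a • fderiv ℝ ψ x v + b • fderiv ℝ ψ x w) →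
    fderiv ℝ n x w = -(c • fderiv ℝ ψ x v + d • fderiv ℝ ψ x w) →
    a + d = 2 * H ∧ a * d - b * c = K x

namespace ParamSurface

variable {ψ n : EuclideanSpace ℝ (Fin 2) → E3} {H : ℝ} {K : EuclideanSpace ℝ (Fin 2) → ℝ}
  {U : Set (EuclideanSpace ℝ (Fin 2))}

theorem inner_normal_dirDeriv_normal (h : ParamSurface ψ n U) {x : EuclideanSpace ℝ (Fin 2)}
    (hx : x ∈ U) (f : EuclideanSpace ℝ (Fin 2) → EuclideanSpace ℝ (Fin 2)) :
    inner ℝ (n x) (dirDeriv f n x) = (0 : ℝ) := by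
  have hn := h.smooth_normal.differentiableAt_of_isOpen h.isOpen hx
  have i₁ := dirDeriv_inner (e := f) hn hn
  rw [dirDeriv_congr h.isOpen h.inner_normal_normal hx, dirDeriv_const,
    real_inner_comm (n x) (dirDeriv f n x)] at i₁
  linarith

/-- The second fundamental form is symmetric. -/
theorem inner_dirDeriv_comm (h : ParamSurface ψ n U)
    {f g : EuclideanSpace ℝ (Fin 2) → EuclideanSpace ℝ (Fin 2)} (hf : ContDiffOn ℝ ∞ f U)
    (hg : ContDiffOn ℝ ∞ g U) {x : EuclideanSpace ℝ (Fin 2)} (hx : x ∈ U) :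
    (inner ℝ (dirDeriv f n x) (dirDeriv g ψ x) : ℝ)
      = inner ℝ (dirDeriv g n x) (dirDeriv f ψ x) := by
  have hn := h.smooth_normal.differentiableAt_of_isOpen h.isOpen hx
  have hF := (h.smooth_param.dirDeriv hf h.isOpen).differentiableAt_of_isOpen h.isOpen hx
  have hG := (h.smooth_param.dirDeriv hg h.isOpen).differentiableAt_of_isOpen h.isOpen hx
  have i₁ := dirDeriv_inner (e := f) hn hG
  have i₂ := dirDeriv_inner (e := g) hn hF
  rw [dirDeriv_congr h.isOpen (f := fun y => (inner ℝ (n y) (dirDeriv g ψ y) : ℝ))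
    (fun y hy => h.inner_normal y hy (g y)) hx, dirDeriv_const] at i₁
  rw [dirDeriv_congr h.isOpen (f := fun y => (inner ℝ (n y) (dirDeriv f ψ y) : ℝ))
    (fun y hy => h.inner_normal y hy (f y)) hx, dirDeriv_const] at i₂
  have i₃ := h.inner_normal x hx (dirDeriv f g x - dirDeriv g f x)
  rw [← dirDeriv_dirDeriv_sub h.isOpen h.smooth_param hf hg hx, inner_sub_right] at i₃
  linarith

/-- Gram–Schmidt for the induced metric, applied to the two coordinate fields. -/
theorem exists_orthonormal_frame (h : ParamSurface ψ n U) :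
    ∃ f₁ f₂ : EuclideanSpace ℝ (Fin 2) → EuclideanSpace ℝ (Fin 2),
      ContDiffOn ℝ ∞ f₁ U ∧ ContDiffOn ℝ ∞ f₂ U ∧ ∀ x ∈ U,
        inner ℝ (dirDeriv f₁ ψ x) (dirDeriv f₁ ψ x) = (1 : ℝ) ∧
        inner ℝ (dirDeriv f₂ ψ x) (dirDeriv f₂ ψ x) = (1 : ℝ) ∧
        inner ℝ (dirDeriv f₁ ψ x) (dirDeriv f₂ ψ x) = (0 : ℝ) := by
  have unit : ∀ g : EuclideanSpace ℝ (Fin 2) → EuclideanSpace ℝ (Fin 2), ContDiffOn ℝ ∞ g U →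
      (∀ x ∈ U, g x ≠ 0) → ContDiffOn ℝ ∞ (fun x => ‖dirDeriv g ψ x‖⁻¹ • g x) U ∧
      ∀ x ∈ U, ‖dirDeriv g ψ x‖⁻¹ ≠ 0 ∧
        inner ℝ (dirDeriv (fun x => ‖dirDeriv g ψ x‖⁻¹ • g x) ψ x)
          (dirDeriv (fun x => ‖dirDeriv g ψ x‖⁻¹ • g x) ψ x) = (1 : ℝ) := by
    intro g hg hg0
    have hne : ∀ x ∈ U, dirDeriv g ψ x ≠ 0 := fun x hx h0 =>
      hg0 x hx (h.injective x hx (by simpa [dirDeriv] using h0))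
    refine ⟨(((h.smooth_param.dirDeriv hg h.isOpen).norm ℝ hne).inv
      (fun x hx => norm_ne_zero_iff.mpr (hne x hx))).smul hg, fun x hx => ?_⟩
    have hx0 := norm_ne_zero_iff.mpr (hne x hx)
    refine ⟨inv_ne_zero hx0, ?_⟩
    have : dirDeriv (fun x => ‖dirDeriv g ψ x‖⁻¹ • g x) ψ x
        = ‖dirDeriv g ψ x‖⁻¹ • dirDeriv g ψ x := by simp [dirDeriv]
    rw [this, inner_smul_left, inner_smul_right, real_inner_self_eq_norm_sq]
    simp only [conj_trivial]
    field_simp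
  obtain ⟨h₁, h₁'⟩ := unit (fun _ => EuclideanSpace.single 0 1) contDiffOn_const
    (fun x hx => by simp)
  set f₁ : EuclideanSpace ℝ (Fin 2) → EuclideanSpace ℝ (Fin 2) :=
    fun x => ‖dirDeriv (fun _ => EuclideanSpace.single 0 1) ψ x‖⁻¹ • EuclideanSpace.single 0 1
  let b : EuclideanSpace ℝ (Fin 2) → EuclideanSpace ℝ (Fin 2) :=
    fun _ => EuclideanSpace.single 1 1
  let g : EuclideanSpace ℝ (Fin 2) → EuclideanSpace ℝ (Fin 2) :=
    fun x => b x - (inner ℝ (dirDeriv f₁ ψ x) (dirDeriv b ψ x) : ℝ) • f₁ x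
  have hg : ContDiffOn ℝ ∞ g U := contDiffOn_const.sub
    (((h.smooth_param.dirDeriv h₁ h.isOpen).inner ℝ
      (h.smooth_param.dirDeriv contDiffOn_const h.isOpen)).smul h₁)
  have hg0 : ∀ x ∈ U, g x ≠ 0 := by
    intro x _ h0
    -- `f₁` is a multiple of the first coordinate field, so the second coordinate of `g x` is `1`.
    have := congrArg (fun v : EuclideanSpace ℝ (Fin 2) => v 1) h0
    simp [g, b, f₁] at this
  obtain ⟨h₂, h₂'⟩ := unit g hg hg0
  refine ⟨f₁, _, h₁, h₂, fun x hx => ⟨(h₁' x hx).2, (h₂' x hx).2, ?_⟩⟩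
  have e₁ : dirDeriv (fun x => ‖dirDeriv g ψ x‖⁻¹ • g x) ψ x
      = ‖dirDeriv g ψ x‖⁻¹ • (dirDeriv b ψ x
        - (inner ℝ (dirDeriv f₁ ψ x) (dirDeriv b ψ x) : ℝ) • dirDeriv f₁ ψ x) := by
    simp [dirDeriv, g]
  rw [e₁, inner_smul_right, inner_sub_right, inner_smul_right, (h₁' x hx).2]
  simp

theorem exists_shapeFrame (h : ParamSurface ψ n U) (hc : HasCurvatures ψ n H K U) :
    ∃ A B f₁ f₂, ShapeFrame ψ n H A B f₁ f₂ U ∧ ∀ x ∈ U, A x ^ 2 + B x ^ 2 = H ^ 2 - K x := by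
  obtain ⟨f₁, f₂, h₁, h₂, ho⟩ := h.exists_orthonormal_frame
  let F₁ := dirDeriv f₁ ψ
  let F₂ := dirDeriv f₂ ψ
  have sF₁ : ContDiffOn ℝ ∞ F₁ U := h.smooth_param.dirDeriv h₁ h.isOpen
  have sF₂ : ContDiffOn ℝ ∞ F₂ U := h.smooth_param.dirDeriv h₂ h.isOpen
  have sn₁ := h.smooth_normal.dirDeriv h₁ h.isOpen
  have expand : ∀ x ∈ U, ∀ f : EuclideanSpace ℝ (Fin 2) → EuclideanSpace ℝ (Fin 2),
      dirDeriv f n x = (inner ℝ (dirDeriv f n x) (F₁ x) : ℝ) • F₁ x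
        + (inner ℝ (dirDeriv f n x) (F₂ x) : ℝ) • F₂ x := by
    intro x hx f
    obtain ⟨a₁, a₂, a₃⟩ := ho x hx
    have n₁ : inner ℝ (n x) (dirDeriv f₁ ψ x) = (0 : ℝ) := h.inner_normal x hx _
    have n₂ : inner ℝ (n x) (dirDeriv f₂ ψ x) = (0 : ℝ) := h.inner_normal x hx _
    have a₃' : inner ℝ (dirDeriv f₂ ψ x) (dirDeriv f₁ ψ x) = (0 : ℝ) := by
      rw [real_inner_comm]; exact a₃
    refine eq_of_inner_orthonormal a₁ a₂ (h.inner_normal_normal x hx) a₃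
      (by rw [real_inner_comm]; exact n₁) (by rw [real_inner_comm]; exact n₂) ?_ ?_ ?_
    · simp only [F₁, F₂, inner_add_right, inner_smul_right, a₁, a₃]
      rw [real_inner_comm]; ring
    · simp only [F₁, F₂, inner_add_right, inner_smul_right, a₂, a₃']
      rw [real_inner_comm]; ring
    · simp only [F₁, F₂, inner_add_right, inner_smul_right, n₁, n₂,
        h.inner_normal_dirDeriv_normal hx]
      ring
  let A : EuclideanSpace ℝ (Fin 2) → ℝ := fun x => -inner ℝ (dirDeriv f₁ n x) (F₁ x) - H
  let B : EuclideanSpace ℝ (Fin 2) → ℝ := fun x => -inner ℝ (dirDeriv f₁ n x) (F₂ x)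
  have d₁ : ∀ x ∈ U,
      dirDeriv f₁ n x = -((H + A x) • dirDeriv f₁ ψ x + B x • dirDeriv f₂ ψ x) := by
    intro x hx
    have := expand x hx f₁
    rw [this]
    simp only [A, B]
    module
  have d₂ : ∀ x ∈ U, dirDeriv f₂ n x
      = -(B x • dirDeriv f₁ ψ x + (-inner ℝ (dirDeriv f₂ n x) (F₂ x) : ℝ) • dirDeriv f₂ ψ x) := by
    intro x hx
    have e := expand x hx f₂
    have hs : (inner ℝ (dirDeriv f₂ n x) (F₁ x) : ℝ) = inner ℝ (dirDeriv f₁ n x) (F₂ x) :=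
      h.inner_dirDeriv_comm h₂ h₁ hx
    rw [hs] at e
    conv_lhs => rw [e]
    simp only [B]
    module
  -- The trace part identifies the remaining diagonal entry as `H - A`; the determinant part then
  -- reads `H² - A² - B² = K`.
  have hcx : ∀ x ∈ U, _ := fun x hx => hc x hx (f₁ x) (f₂ x) _ _ _ _ (ho x hx).1 (ho x hx).2.1
    (ho x hx).2.2 (d₁ x hx) (d₂ x hx)
  have htr : ∀ x ∈ U, -inner ℝ (dirDeriv f₂ n x) (F₂ x) = H - A x := fun x hx => by
    linarith [(hcx x hx).1]
  refine ⟨A, B, f₁, f₂, ⟨(sn₁.inner ℝ sF₁).neg.sub contDiffOn_const, (sn₁.inner ℝ sF₂).neg,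
    h₁, h₂, fun x hx => (ho x hx).1, fun x hx => (ho x hx).2.1, fun x hx => (ho x hx).2.2,
    d₁, fun x hx => ?_⟩, fun x hx => ?_⟩
  · rw [← htr x hx]
    exact d₂ x hx
  · have := (hcx x hx).2
    rw [htr x hx] at this
    linarith

/-- At an umbilic the differential of the normal is a multiple of that of the parametrization. -/
theorem fderiv_normal_of_umbilic (h : ParamSurface ψ n U) (hc : HasCurvatures ψ n H K U)
    {x : EuclideanSpace ℝ (Fin 2)} (hx : x ∈ U) (hK : K x = H ^ 2)
    (v : EuclideanSpace ℝ (Fin 2)) : fderiv ℝ n x v = -(H • fderiv ℝ ψ x v) := by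
  obtain ⟨A, B, f₁, f₂, hf, hq⟩ := h.exists_shapeFrame hc
  have h0 := hq x hx
  have hA : A x = 0 := by nlinarith [sq_nonneg (A x), sq_nonneg (B x)]
  have hB : B x = 0 := by nlinarith [sq_nonneg (A x), sq_nonneg (B x)]
  have d₁ := hf.dirDeriv_left_normal x hx
  have d₂ := hf.dirDeriv_right_normal x hx
  simp only [hA, hB, add_zero, zero_add, zero_smul, sub_zero] at d₁ d₂
  have hsp := span_pair_eq_top_of_orthonormal_image (fderiv ℝ ψ x).toLinearMap (by simp)
    (hf.inner_left x hx) (hf.inner_right x hx) (hf.inner_left_right x hx)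
  have : (fderiv ℝ n x).toLinearMap = -(H • (fderiv ℝ ψ x).toLinearMap) := by
    refine LinearMap.ext_on hsp ?_
    rintro _ ⟨i, rfl⟩
    fin_cases i
    · simpa [dirDeriv] using d₁
    · simpa [dirDeriv] using d₂
  exact congrArg (fun L : EuclideanSpace ℝ (Fin 2) →ₗ[ℝ] E3 => L v) this

end ParamSurface

namespace ShapeFrame

variable {ψ n : EuclideanSpace ℝ (Fin 2) → E3} {H : ℝ} {A B : EuclideanSpace ℝ (Fin 2) → ℝ}
  {f₁ f₂ : EuclideanSpace ℝ (Fin 2) → EuclideanSpace ℝ (Fin 2)}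
  {U : Set (EuclideanSpace ℝ (Fin 2))}

theorem swap (h : ShapeFrame ψ n H A B f₁ f₂ U) :
    ShapeFrame ψ n H (fun x => -A x) B f₂ f₁ U where
  smooth_diag := h.smooth_diag.neg
  smooth_offDiag := h.smooth_offDiag
  smooth_left := h.smooth_right
  smooth_right := h.smooth_left
  inner_left := h.inner_right
  inner_right := h.inner_left
  inner_left_right x hx := by rw [real_inner_comm]; exact h.inner_left_right x hx
  dirDeriv_left_normal x hx := by rw [h.dirDeriv_right_normal x hx]; module
  dirDeriv_right_normal x hx := by rw [h.dirDeriv_left_normal x hx]; module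

/-- With `s = √(A² + B²)`, the vector `(s + A, B)` is an eigenvector of `!![A, B; B, -A]` for `s`.
It degenerates only where `A = -s`, which the sign of `A x₀` excludes near `x₀`. -/
theorem exists_principalFrame_of_nonneg (h : ShapeFrame ψ n H A B f₁ f₂ U)
    (hψ : ParamSurface ψ n U) {x₀ : EuclideanSpace ℝ (Fin 2)} (hx₀ : x₀ ∈ U) (hA : 0 ≤ A x₀)
    (hq : 0 < A x₀ ^ 2 + B x₀ ^ 2) :
    ∃ U' ⊆ U, x₀ ∈ U' ∧ ∃ s e₁ e₂, PrincipalFrame ψ n H s e₁ e₂ U' ∧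
      ∀ x ∈ U', s x ^ 2 = A x ^ 2 + B x ^ 2 := by
  let s : EuclideanSpace ℝ (Fin 2) → ℝ := fun x => √(A x ^ 2 + B x ^ 2)
  have sq : ContDiffOn ℝ ∞ (fun x => A x ^ 2 + B x ^ 2) U :=
    (h.smooth_diag.pow 2).add (h.smooth_offDiag.pow 2)
  have cs : ContinuousOn (fun x => s x + A x) U :=
    sq.continuousOn.sqrt.add h.smooth_diag.continuousOn
  let U' := U ∩ ((fun x => A x ^ 2 + B x ^ 2) ⁻¹' Set.Ioi 0 ∩ (fun x => s x + A x) ⁻¹' Set.Ioi 0)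
  have hU' : IsOpen U' := by
    have := (sq.continuousOn.isOpen_inter_preimage hψ.isOpen (isOpen_Ioi (a := (0 : ℝ)))).inter
      (cs.isOpen_inter_preimage hψ.isOpen (isOpen_Ioi (a := (0 : ℝ))))
    rwa [← Set.inter_inter_distrib_left] at this
  have hsub : U' ⊆ U := Set.inter_subset_left
  have hspos : ∀ x ∈ U', 0 < s x := fun x hx => Real.sqrt_pos.mpr hx.2.1
  have hsA : ∀ x ∈ U', 0 < s x + A x := fun x hx => hx.2.2
  have hs2 : ∀ x, s x ^ 2 = A x ^ 2 + B x ^ 2 := fun x => Real.sq_sqrt (by positivity)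
  have ss : ContDiffOn ℝ ∞ s U' := (sq.mono hsub).sqrt fun x hx => ne_of_gt hx.2.1
  have sA := h.smooth_diag.mono hsub
  have sB := h.smooth_offDiag.mono hsub
  -- The length of the eigenvector, since `(s + A)² + B² = 2s(s + A)`; `c` and `t` below are the
  -- cosine and sine of the rotation angle.
  let m : EuclideanSpace ℝ (Fin 2) → ℝ := fun x => √(2 * s x * (s x + A x))
  have hm : ∀ x ∈ U', 0 < 2 * s x * (s x + A x) := fun x hx =>
    mul_pos (mul_pos two_pos (hspos x hx)) (hsA x hx)
  have hmpos : ∀ x ∈ U', 0 < m x := fun x hx => Real.sqrt_pos.mpr (hm x hx)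
  have hm2 : ∀ x ∈ U', m x ^ 2 = 2 * s x * (s x + A x) := fun x hx => Real.sq_sqrt (hm x hx).le
  have sm : ContDiffOn ℝ ∞ m U' :=
    ((contDiffOn_const.mul ss).mul (ss.add sA)).sqrt fun x hx => (hm x hx).ne'
  let c : EuclideanSpace ℝ (Fin 2) → ℝ := fun x => (s x + A x) / m x
  let t : EuclideanSpace ℝ (Fin 2) → ℝ := fun x => B x / m x
  have sc : ContDiffOn ℝ ∞ c U' := (ss.add sA).div sm fun x hx => (hmpos x hx).ne'
  have st : ContDiffOn ℝ ∞ t U' := sB.div sm fun x hx => (hmpos x hx).ne'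
  have hct : ∀ x ∈ U', c x ^ 2 + t x ^ 2 = 1 := by
    intro x hx
    have := (hmpos x hx).ne'
    simp only [c, t]
    field_simp
    rw [hm2 x hx]
    linear_combination - hs2 x
  have hd₁ : ∀ x ∈ U', A x * c x + B x * t x = s x * c x := by
    intro x hx
    have := (hmpos x hx).ne'
    simp only [c, t]
    field_simp
    linear_combination - hs2 x
  have hd₂ : ∀ x ∈ U', B x * c x - A x * t x = s x * t x := by
    intro x hx
    simp only [c, t]
    ring
  have D₁ : ∀ (F : EuclideanSpace ℝ (Fin 2) → E3) x,
      dirDeriv (fun x => c x • f₁ x + t x • f₂ x) F x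
        = c x • dirDeriv f₁ F x + t x • dirDeriv f₂ F x := by
    intro F x; simp [dirDeriv]
  have D₂ : ∀ (F : EuclideanSpace ℝ (Fin 2) → E3) x,
      dirDeriv (fun x => -t x • f₁ x + c x • f₂ x) F x
        = -t x • dirDeriv f₁ F x + c x • dirDeriv f₂ F x := by
    intro F x; simp [dirDeriv]
  have hc' : ∀ x ∈ U', (inner ℝ (dirDeriv f₂ ψ x) (dirDeriv f₁ ψ x) : ℝ) = 0 := fun x hx => by
    rw [real_inner_comm]; exact h.inner_left_right x (hsub hx)
  refine ⟨U', hsub, ⟨hx₀, hq, add_pos_of_pos_of_nonneg (Real.sqrt_pos.mpr hq) hA⟩, s,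
    fun x => c x • f₁ x + t x • f₂ x, fun x => -t x • f₁ x + c x • f₂ x, ?_, fun x _ => hs2 x⟩
  have s₁ := h.smooth_left.mono hsub
  have s₂ := h.smooth_right.mono hsub
  refine ⟨hU', hψ.smooth_param.mono hsub, hψ.smooth_normal.mono hsub, ss,
    (sc.smul s₁).add (st.smul s₂), (st.neg.smul s₁).add (sc.smul s₂),
    fun x hx => (hspos x hx).ne', fun x hx => hψ.injective x (hsub hx), ?_, ?_, ?_,
    fun x hx => hψ.inner_normal_normal x (hsub hx), fun x hx => hψ.inner_normal x (hsub hx) _,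
    fun x hx => hψ.inner_normal x (hsub hx) _, ?_, ?_⟩
  · intro x hx
    simp only [D₁, inner_add_left, inner_add_right, inner_smul_left, inner_smul_right,
      h.inner_left x (hsub hx), h.inner_right x (hsub hx), h.inner_left_right x (hsub hx),
      hc' x hx, conj_trivial]
    linear_combination hct x hx
  · intro x hx
    simp only [D₂, inner_add_left, inner_add_right, inner_smul_left, inner_smul_right,
      h.inner_left x (hsub hx), h.inner_right x (hsub hx), h.inner_left_right x (hsub hx),
      hc' x hx, conj_trivial]
    linear_combination hct x hx
  · intro x hx
    simp only [D₁, D₂, inner_add_left, inner_add_right, inner_smul_left, inner_smul_right,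
      h.inner_left x (hsub hx), h.inner_right x (hsub hx), h.inner_left_right x (hsub hx),
      hc' x hx, conj_trivial]
    ring
  · intro x hx
    rw [D₁, D₁, h.dirDeriv_left_normal x (hsub hx), h.dirDeriv_right_normal x (hsub hx)]
    match_scalars
    · linear_combination -hd₁ x hx
    · linear_combination -hd₂ x hx
  · intro x hx
    rw [D₂, D₂, h.dirDeriv_left_normal x (hsub hx), h.dirDeriv_right_normal x (hsub hx)]
    match_scalars
    · linear_combination -hd₂ x hx
    · linear_combination hd₁ x hx

end ShapeFrame

/-- Near a point which is not umbilic there is a smooth principal frame. -/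
theorem ParamSurface.exists_principalFrame {ψ n : EuclideanSpace ℝ (Fin 2) → E3} {H : ℝ}
    {K : EuclideanSpace ℝ (Fin 2) → ℝ} {U : Set (EuclideanSpace ℝ (Fin 2))}
    (h : ParamSurface ψ n U) (hc : HasCurvatures ψ n H K U) {x₀ : EuclideanSpace ℝ (Fin 2)}
    (hx₀ : x₀ ∈ U) (hK : K x₀ < H ^ 2) :
    ∃ U' ⊆ U, x₀ ∈ U' ∧ ∃ s e₁ e₂, PrincipalFrame ψ n H s e₁ e₂ U' ∧
      ∀ x ∈ U', K x = H ^ 2 - s x ^ 2 := by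
  obtain ⟨A, B, f₁, f₂, hf, hq⟩ := h.exists_shapeFrame hc
  have hpos : 0 < A x₀ ^ 2 + B x₀ ^ 2 := by rw [hq x₀ hx₀]; linarith
  have aux : ∃ U' ⊆ U, x₀ ∈ U' ∧ ∃ s e₁ e₂, PrincipalFrame ψ n H s e₁ e₂ U' ∧
      ∀ x ∈ U', s x ^ 2 = A x ^ 2 + B x ^ 2 := by
    rcases le_total 0 (A x₀) with hA | hA
    · exact hf.exists_principalFrame_of_nonneg h hx₀ hA hpos
    · simpa using hf.swap.exists_principalFrame_of_nonneg h hx₀ (by simpa using hA)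
        (by simpa using hpos)
  obtain ⟨U', hU', hx, s, e₁, e₂, hp, hs⟩ := aux
  exact ⟨U', hU', hx, s, e₁, e₂, hp, fun x hx => by linarith [hs x hx, hq x (hU' hx)]⟩

/-! ### Passage between the manifold and its charts; open pieces. -/

section SurfDiff

variable {M : Type*} [TopologicalSpace M] [ChartedSpace (EuclideanSpace ℝ (Fin 2)) M]

theorem surfDiff_const (c : E3) (p : M) : surfDiff (fun _ : M => c) p = 0 := by
  refine LinearMap.ext fun v => ?_
  simp [surfDiff]
  rfl

/-- The form `T (F + a • G)` covers all auxiliary maps used later: centres, projections to an axis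
complement, and, with `a = 0`, linear images. -/
theorem surfDiff_clm_comp_add {F G : M → E3} {p : M} (hF : MDifferentiableAt (𝓡 2) 𝓘(ℝ, E3) F p)
    (hG : MDifferentiableAt (𝓡 2) 𝓘(ℝ, E3) G p) (T : E3 →L[ℝ] E3) (a : ℝ)
    (v : TangentSpace (𝓡 2) p) :
    surfDiff (fun q => T (F q + a • G q)) p v = T (surfDiff F p v + a • surfDiff G p v) := by
  have h₁ := hF.hasMFDerivAt.add (hG.hasMFDerivAt.const_smul a)
  have h₂ := HasMFDerivAt.comp p (T.hasMFDerivAt (x := (F + a • G) p)) h₁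
  exact congrArg (fun L : TangentSpace (𝓡 2) p →L[ℝ] E3 => L v) h₂.mfderiv

/-- Curvatures from the matrix of the shape operator in an orthonormal basis. -/
theorem curvatures_of_orthonormal_basis {Φ N : M → E3} (h : IsOrientedImmersion Φ N) (p : M)
    {v w : TangentSpace (𝓡 2) p} {a b c d : ℝ}
    (hv : inner ℝ (surfDiff Φ p v) (surfDiff Φ p v) = (1 : ℝ))
    (hw : inner ℝ (surfDiff Φ p w) (surfDiff Φ p w) = (1 : ℝ))
    (hvw : inner ℝ (surfDiff Φ p v) (surfDiff Φ p w) = (0 : ℝ))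
    (hdv : surfDiff N p v = -(a • surfDiff Φ p v + b • surfDiff Φ p w))
    (hdw : surfDiff N p w = -(c • surfDiff Φ p v + d • surfDiff Φ p w)) :
    meanCurvature Φ N p = (a + d) / 2 ∧ gaussCurvature Φ N p = a * d - b * c := by
  have hfin : Module.finrank ℝ (TangentSpace (𝓡 2) p) = 2 := finrank_euclideanSpace_fin
  let B := basisOfLinearIndependentOfCardEqFinrank
    (linearIndependent_of_orthonormal_image (surfDiff Φ p) hv hw hvw) (by simp [hfin])
  have hB₀ : B 0 = v := by simp [B]
  have hB₁ : B 1 = w := by simp [B]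
  have hSv : shapeOperator Φ N p v = a • B 0 + b • B 1 := by
    apply h.injective p
    rw [surfDiff_shapeOperator h, hdv, hB₀, hB₁]
    simp
  have hSw : shapeOperator Φ N p w = c • B 0 + d • B 1 := by
    apply h.injective p
    rw [surfDiff_shapeOperator h, hdw, hB₀, hB₁]
    simp
  have hM : LinearMap.toMatrix B B (shapeOperator Φ N p) = !![a, c; b, d] := by
    ext i j
    rw [LinearMap.toMatrix_apply]
    fin_cases j
    · rw [Fin.zero_eta, hB₀, hSv]
      simp only [map_add, map_smul, B.repr_self]
      fin_cases i <;> simp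
    · rw [Fin.mk_one, hB₁, hSw]
      simp only [map_add, map_smul, B.repr_self]
      fin_cases i <;> simp
  constructor
  · rw [meanCurvature, LinearMap.trace_eq_matrix_trace ℝ B, hM, Matrix.trace_fin_two_of]
  · rw [gaussCurvature, ← LinearMap.det_toMatrix B, hM, Matrix.det_fin_two_of]
    ring

theorem eventually_nhds_of_chartAt {P : M → Prop} (p₀ : M)
    (h : ∀ᶠ x in nhds (chartAt (EuclideanSpace ℝ (Fin 2)) p₀ p₀),
      P ((chartAt (EuclideanSpace ℝ (Fin 2)) p₀).symm x)) : ∀ᶠ p in nhds p₀, P p := by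
  have hp := mem_chart_source (EuclideanSpace ℝ (Fin 2)) p₀
  have hc := (chartAt (EuclideanSpace ℝ (Fin 2)) p₀).continuousAt hp
  filter_upwards [hc.eventually h,
    (chartAt (EuclideanSpace ℝ (Fin 2)) p₀).open_source.mem_nhds hp] with p h₁ h₂
  rwa [(chartAt (EuclideanSpace ℝ (Fin 2)) p₀).left_inv h₂] at h₁

variable [IsManifold (𝓡 2) ∞ M]

/-- A single isomorphism `L` serves all maps `F`, so relations between `dΦ` and `dN` transfer to the
chart and back. -/
theorem exists_surfDiff_eq_fderiv (p₀ : M) {x : EuclideanSpace ℝ (Fin 2)}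
    (hx : x ∈ (chartAt (EuclideanSpace ℝ (Fin 2)) p₀).target) :
    ∃ L : EuclideanSpace ℝ (Fin 2) →ₗ[ℝ]
        TangentSpace (𝓡 2) ((chartAt (EuclideanSpace ℝ (Fin 2)) p₀).symm x),
      Function.Bijective L ∧ ∀ F : M → E3, ContMDiff (𝓡 2) 𝓘(ℝ, E3) ∞ F → ∀ v,
        surfDiff F ((chartAt (EuclideanSpace ℝ (Fin 2)) p₀).symm x) (L v)
          = fderiv ℝ (F ∘ (chartAt (EuclideanSpace ℝ (Fin 2)) p₀).symm) x v := by
  have : IsManifold (𝓡 2) 1 M := IsManifold.of_le (n := ∞) (by simp)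
  have hd := (mdifferentiable_chart (I := 𝓡 2) p₀).symm
  refine ⟨(mfderiv (𝓡 2) (𝓡 2) (chartAt (EuclideanSpace ℝ (Fin 2)) p₀).symm x).toLinearMap,
    hd.mfderiv_bijective hx, fun F hF v => ?_⟩
  have hF' : MDifferentiableAt (𝓡 2) 𝓘(ℝ, E3) F
      ((chartAt (EuclideanSpace ℝ (Fin 2)) p₀).symm x) := hF.mdifferentiableAt (by simp)
  have hc := mfderiv_comp x hF' (hd.mdifferentiableAt hx)
  rw [← mfderiv_eq_fderiv]
  exact (congrArg (fun L : EuclideanSpace ℝ (Fin 2) →L[ℝ] E3 => L v) hc).symm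

theorem contDiffOn_comp_chartAt_symm {F : M → E3} (hF : ContMDiff (𝓡 2) 𝓘(ℝ, E3) ∞ F) (p₀ : M) :
    ContDiffOn ℝ ∞ (F ∘ (chartAt (EuclideanSpace ℝ (Fin 2)) p₀).symm)
      (chartAt (EuclideanSpace ℝ (Fin 2)) p₀).target :=
  (hF.comp_contMDiffOn (contMDiffOn_chart_symm (I := 𝓡 2))).contDiffOn

theorem IsOrientedImmersion.paramSurface {Φ N : M → E3} (h : IsOrientedImmersion Φ N) (p₀ : M) :
    ParamSurface (Φ ∘ (chartAt (EuclideanSpace ℝ (Fin 2)) p₀).symm)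
      (N ∘ (chartAt (EuclideanSpace ℝ (Fin 2)) p₀).symm)
      (chartAt (EuclideanSpace ℝ (Fin 2)) p₀).target where
  isOpen := (chartAt _ p₀).open_target
  smooth_param := contDiffOn_comp_chartAt_symm h.smooth p₀
  smooth_normal := contDiffOn_comp_chartAt_symm h.smooth_normal p₀
  injective x hx := by
    obtain ⟨L, hL, hLF⟩ := exists_surfDiff_eq_fderiv p₀ hx
    intro v w hvw
    rw [← hLF Φ h.smooth, ← hLF Φ h.smooth] at hvw
    exact hL.1 (h.injective _ hvw)
  inner_normal_normal x _ := by
    rw [real_inner_self_eq_norm_sq, Function.comp_apply, h.norm_normal]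
    norm_num
  inner_normal x hx v := by
    obtain ⟨L, hL, hLF⟩ := exists_surfDiff_eq_fderiv p₀ hx
    rw [← hLF Φ h.smooth]
    exact h.inner_normal _ _

theorem IsOrientedImmersion.hasCurvatures {Φ N : M → E3} (h : IsOrientedImmersion Φ N) {H : ℝ}
    (hH : ∀ p, meanCurvature Φ N p = H) (p₀ : M) :
    HasCurvatures (Φ ∘ (chartAt (EuclideanSpace ℝ (Fin 2)) p₀).symm)
      (N ∘ (chartAt (EuclideanSpace ℝ (Fin 2)) p₀).symm) H
      (gaussCurvature Φ N ∘ (chartAt (EuclideanSpace ℝ (Fin 2)) p₀).symm)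
      (chartAt (EuclideanSpace ℝ (Fin 2)) p₀).target := by
  intro x hx v w a b c d hv hw hvw hdv hdw
  obtain ⟨L, hL, hLF⟩ := exists_surfDiff_eq_fderiv p₀ hx
  simp only [← hLF Φ h.smooth, ← hLF N h.smooth_normal] at hv hw hvw hdv hdw
  obtain ⟨h₁, h₂⟩ := curvatures_of_orthonormal_basis h _ hv hw hvw hdv hdw
  rw [hH] at h₁
  exact ⟨by linarith, h₂.symm⟩

theorem eventually_eq_of_fderiv_eq_zero {V F : Type*} [NormedAddCommGroup V] [NormedSpace ℝ V]
    [NormedAddCommGroup F] [NormedSpace ℝ F] {f : V → F} {x : V}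
    (hf : ∀ᶠ y in nhds x, DifferentiableAt ℝ f y) (h0 : ∀ᶠ y in nhds x, fderiv ℝ f y = 0) :
    ∀ᶠ y in nhds x, f y = f x := by
  obtain ⟨r, hr, hball⟩ := Metric.eventually_nhds_iff_ball.mp (hf.and h0)
  filter_upwards [Metric.ball_mem_nhds x hr] with y hy
  exact Metric.isOpen_ball.is_const_of_fderiv_eq_zero (convex_ball x r).isPreconnected
    (fun z hz => (hball z hz).1.differentiableWithinAt) (fun z hz => (hball z hz).2) hy
    (Metric.mem_ball_self hr)

theorem exists_eq_const_of_surfDiff_eq_zero [ConnectedSpace M] {F : M → E3}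
    (hF : ContMDiff (𝓡 2) 𝓘(ℝ, E3) ∞ F) (h0 : ∀ p v, surfDiff F p v = 0) : ∃ c, ∀ p, F p = c := by
  have hloc : IsLocallyConstant F := by
    rw [IsLocallyConstant.iff_eventually_eq]
    intro p₀
    apply eventually_nhds_of_chartAt
    have hp := mem_chart_source (EuclideanSpace ℝ (Fin 2)) p₀
    have ht := (chartAt (EuclideanSpace ℝ (Fin 2)) p₀).open_target.mem_nhds
      ((chartAt (EuclideanSpace ℝ (Fin 2)) p₀).map_source hp)
    have hs := contDiffOn_comp_chartAt_symm hF p₀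
    have := eventually_eq_of_fderiv_eq_zero
      (f := F ∘ (chartAt (EuclideanSpace ℝ (Fin 2)) p₀).symm)
      (x := chartAt (EuclideanSpace ℝ (Fin 2)) p₀ p₀) ?_ ?_
    · simpa [(chartAt (EuclideanSpace ℝ (Fin 2)) p₀).left_inv hp] using this
    · filter_upwards [ht] with x hx
      exact hs.differentiableAt_of_isOpen (chartAt _ p₀).open_target hx
    · filter_upwards [ht] with x hx
      obtain ⟨L, hL, hLF⟩ := exists_surfDiff_eq_fderiv p₀ hx
      ext1 v
      rw [← hLF F hF, h0]
      rfl
  obtain ⟨p₀⟩ := (inferInstance : Nonempty M)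
  exact ⟨F p₀, fun p => hloc.apply_eq_of_preconnectedSpace p p₀⟩

theorem IsOrientedImmersion.exists_orthonormal_basis {Φ N : M → E3} (h : IsOrientedImmersion Φ N)
    (p : M) : ∃ v w : TangentSpace (𝓡 2) p,
      inner ℝ (surfDiff Φ p v) (surfDiff Φ p v) = (1 : ℝ) ∧
      inner ℝ (surfDiff Φ p w) (surfDiff Φ p w) = (1 : ℝ) ∧
      inner ℝ (surfDiff Φ p v) (surfDiff Φ p w) = (0 : ℝ) := by
  obtain ⟨f₁, f₂, -, -, ho⟩ := (h.paramSurface p).exists_orthonormal_frame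
  have hp := mem_chart_source (EuclideanSpace ℝ (Fin 2)) p
  have hx := (chartAt (EuclideanSpace ℝ (Fin 2)) p).map_source hp
  obtain ⟨L, hL, hLF⟩ := exists_surfDiff_eq_fderiv p hx
  have := ho _ hx
  simp only [dirDeriv, ← hLF Φ h.smooth] at this
  rw [← (chartAt (EuclideanSpace ℝ (Fin 2)) p).left_inv hp]
  exact ⟨_, _, this⟩

/-- An immersed surface which meets `P` in its normal tube only along itself is an open piece
of `P`. -/
theorem IsOrientedImmersion.isOpenPieceOf {Φ N : M → E3} (h : IsOrientedImmersion Φ N)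
    {P : Set E3} {ε : ℝ} (hε : 0 < ε) (hP : ∀ p, Φ p ∈ P)
    (htube : ∀ p t, |t| < ε → Φ p + t • N p ∈ P → t = 0) : IsOpenPieceOf (Set.range Φ) P := by
  -- The open set is the interior of the normal tube of radius `ε`. That it contains the image is
  -- the open mapping property of `(x, t) ↦ ψ x + t n x` at `t = 0`.
  refine ⟨interior {y | ∃ p t, |t| < ε ∧ Φ p + t • N p = y}, isOpen_interior, ?_⟩
  apply Set.Subset.antisymm
  · rintro _ ⟨p₀, rfl⟩
    refine ⟨hP p₀, ?_⟩
    rw [mem_interior_iff_mem_nhds]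
    have hp := mem_chart_source (EuclideanSpace ℝ (Fin 2)) p₀
    have hx := (chartAt (EuclideanSpace ℝ (Fin 2)) p₀).map_source hp
    have hS := h.paramSurface p₀
    have hleft := (chartAt (EuclideanSpace ℝ (Fin 2)) p₀).left_inv hp
    have ht := hS.isOpen.mem_nhds hx
    set φ := chartAt (EuclideanSpace ℝ (Fin 2)) p₀
    set x₀ := φ p₀
    set ψ := Φ ∘ φ.symm
    set n := N ∘ φ.symm
    have dψ : HasStrictFDerivAt ψ (fderiv ℝ ψ x₀) x₀ :=
      (hS.smooth_param.contDiffAt ht).hasStrictFDerivAt (by simp)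
    have dn : HasStrictFDerivAt n (fderiv ℝ n x₀) x₀ :=
      (hS.smooth_normal.contDiffAt ht).hasStrictFDerivAt (by simp)
    have dfst : HasStrictFDerivAt (fun z : EuclideanSpace ℝ (Fin 2) × ℝ => z.1)
        (ContinuousLinearMap.fst ℝ _ _) (x₀, (0 : ℝ)) := hasStrictFDerivAt_fst
    have dsnd : HasStrictFDerivAt (fun z : EuclideanSpace ℝ (Fin 2) × ℝ => z.2)
        (ContinuousLinearMap.snd ℝ _ _) (x₀, (0 : ℝ)) := hasStrictFDerivAt_snd
    let L : EuclideanSpace ℝ (Fin 2) × ℝ →L[ℝ] E3 :=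
      (fderiv ℝ ψ x₀).comp (ContinuousLinearMap.fst ℝ _ _)
        + (ContinuousLinearMap.snd ℝ _ _).smulRight (n x₀)
    have dG : HasStrictFDerivAt (fun z : EuclideanSpace ℝ (Fin 2) × ℝ => ψ z.1 + z.2 • n z.1) L
        (x₀, (0 : ℝ)) := by
      have := (HasStrictFDerivAt.comp (x₀, (0 : ℝ)) dψ dfst).add
        (dsnd.smul (HasStrictFDerivAt.comp (x₀, (0 : ℝ)) dn dfst))
      refine this.congr_fderiv ?_
      refine ContinuousLinearMap.ext fun z => ?_
      simp [L]
    -- Both spaces have dimension `3`, so injectivity suffices; pairing with `n` isolates `t`, and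
    -- the immersion property gives `v = 0`.
    have hsurj : L.range = ⊤ := LinearMap.range_eq_top.mpr
      ((LinearMap.injective_iff_surjective_of_finrank_eq_finrank (f := L.toLinearMap) (by simp)).mp
        ?_)
    · have hmap := dG.map_nhds_eq_of_surj hsurj
      have hmem : φ.target ×ˢ Metric.ball (0 : ℝ) ε ∈ nhds (x₀, (0 : ℝ)) :=
        prod_mem_nhds ht (Metric.ball_mem_nhds 0 hε)
      have himg := Filter.image_mem_map hmem (m := fun z : EuclideanSpace ℝ (Fin 2) × ℝ =>
        ψ z.1 + z.2 • n z.1)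
      have hval : ψ x₀ + (0 : ℝ) • n x₀ = Φ p₀ := by simp [ψ, hleft]
      rw [hmap, hval] at himg
      refine Filter.mem_of_superset himg ?_
      rintro _ ⟨⟨x, t⟩, ⟨_, ht'⟩, rfl⟩
      exact ⟨φ.symm x, t, by simpa using ht', rfl⟩
    · rw [← LinearMap.ker_eq_bot, LinearMap.ker_eq_bot']
      rintro ⟨v, t⟩ hvt
      have hvt' : fderiv ℝ ψ x₀ v + t • n x₀ = 0 := by simpa [L] using hvt
      have ht0 : t = 0 := by
        have := congrArg (fun y => (inner ℝ (n x₀) y : ℝ)) hvt'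
        simpa [inner_add_right, inner_smul_right, hS.inner_normal x₀ hx,
          hS.inner_normal_normal x₀ hx, -inner_self_eq_norm_sq_to_K] using this
      have hv0 : v = 0 := hS.injective x₀ hx (by simpa [ht0] using hvt')
      rw [ht0, hv0]
      rfl
  · rintro y ⟨hyP, hy⟩
    obtain ⟨p, t, ht, rfl⟩ := interior_subset hy
    have := htube p t ht hyP
    exact ⟨p, by simp [this]⟩

end SurfDiff

/-! ### The umbilic and the flat case, and the classification. -/

/-- At a point where one principal curvature vanishes, the local direction of vanishing curvature
is constant in `ℝ³`. -/
theorem PrincipalFrame.eventually_parallel {ψ n : EuclideanSpace ℝ (Fin 2) → E3} {H : ℝ}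
    {s : EuclideanSpace ℝ (Fin 2) → ℝ}
    {e₁ e₂ : EuclideanSpace ℝ (Fin 2) → EuclideanSpace ℝ (Fin 2)}
    {U : Set (EuclideanSpace ℝ (Fin 2))} {α lam : ℝ} (h : PrincipalFrame ψ n H s e₁ e₂ U)
    (hK : ∀ x ∈ U, H ^ 2 - s x ^ 2 = α * inner ℝ (n x) (ψ x) + lam)
    {x₀ : EuclideanSpace ℝ (Fin 2)} (hx₀ : x₀ ∈ U) (hs : s x₀ = H) :
    ∃ E : E3, inner ℝ E E = (1 : ℝ) ∧ ∀ᶠ x in nhds x₀, ∃ v w, fderiv ℝ ψ x v = E ∧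
      fderiv ℝ n x v = 0 ∧ inner ℝ (fderiv ℝ ψ x w) (fderiv ℝ ψ x w) = (1 : ℝ) ∧
      inner ℝ (fderiv ℝ ψ x v) (fderiv ℝ ψ x w) = (0 : ℝ) ∧
      fderiv ℝ n x w = -((2 * H) • fderiv ℝ ψ x w) := by
  have hU := h.isOpen.mem_nhds hx₀
  -- Flatness gives `s = H` or `s = -H`; these differ because `s ≠ 0`, so continuity keeps the sign.
  have hsH : ∀ᶠ x in nhds x₀, s x = H := by
    have hc := (h.differentiableAt_s hx₀).continuousAt
    have hH : H ≠ 0 := hs ▸ h.s_ne_zero x₀ hx₀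
    have hne : s x₀ ≠ -H := fun h' => hH (by linarith)
    filter_upwards [hU, hc.eventually_ne hne] with x hx hx'
    rcases sq_eq_sq_iff_eq_or_eq_neg.mp (h.sq_eq_sq hK hx) with h' | h'
    · exact h'
    · exact absurd h' hx'
  have hconst : ∀ᶠ x in nhds x₀, dirDeriv e₂ ψ x = dirDeriv e₂ ψ x₀ := by
    apply eventually_eq_of_fderiv_eq_zero
    · filter_upwards [hU] with x hx
      exact h.swap.smooth_dirDeriv_left.differentiableAt_of_isOpen h.isOpen hx
    · filter_upwards [hU, hsH] with x hx hx'
      exact h.fderiv_dirDeriv_right_eq_zero hK hx hx'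
  refine ⟨dirDeriv e₂ ψ x₀, h.inner_right x₀ hx₀, ?_⟩
  filter_upwards [hU, hsH, hconst] with x hx hx' hx''
  have d₁ := h.dirDeriv_left_normal x hx
  have d₂ := h.dirDeriv_right_normal x hx
  refine ⟨e₂ x, e₁ x, hx'', ?_, h.inner_left x hx, ?_, ?_⟩
  · rw [hx'] at d₂
    simpa [dirDeriv] using d₂
  · rw [real_inner_comm]
    exact h.inner_left_right x hx
  · rw [hx', ← two_mul] at d₁
    exact d₁

/-- `v` and `w` are tangent vectors at `p` with orthonormal images, in principal directions of
curvature `0` and `κ`. -/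
structure IsFlatBasis {M : Type*} [TopologicalSpace M]
    [ChartedSpace (EuclideanSpace ℝ (Fin 2)) M] (Φ N : M → E3) (κ : ℝ) (p : M)
    (v w : TangentSpace (𝓡 2) p) : Prop where
  inner_left : inner ℝ (surfDiff Φ p v) (surfDiff Φ p v) = (1 : ℝ)
  inner_right : inner ℝ (surfDiff Φ p w) (surfDiff Φ p w) = (1 : ℝ)
  inner_left_right : inner ℝ (surfDiff Φ p v) (surfDiff Φ p w) = (0 : ℝ)
  normal_left : surfDiff N p v = 0
  normal_right : surfDiff N p w = -(κ • surfDiff Φ p w)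

section

variable {M : Type*} [TopologicalSpace M] [ChartedSpace (EuclideanSpace ℝ (Fin 2)) M]

theorem exists_eq_smul_add_smul {Φ : M → E3} {p : M} {v w : TangentSpace (𝓡 2) p}
    (hv : inner ℝ (surfDiff Φ p v) (surfDiff Φ p v) = (1 : ℝ))
    (hw : inner ℝ (surfDiff Φ p w) (surfDiff Φ p w) = (1 : ℝ))
    (hvw : inner ℝ (surfDiff Φ p v) (surfDiff Φ p w) = (0 : ℝ)) (y : TangentSpace (𝓡 2) p) :
    ∃ a b : ℝ, y = a • v + b • w := by
  have hsp := span_pair_eq_top_of_orthonormal_image (surfDiff Φ p)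
    (finrank_euclideanSpace_fin (𝕜 := ℝ) (n := 2)) hv hw hvw
  have hy : y ∈ Submodule.span ℝ (Set.range ![v, w]) := hsp ▸ Submodule.mem_top
  rw [Matrix.range_cons_cons_empty, Submodule.mem_span_pair] at hy
  obtain ⟨a, b, hab⟩ := hy
  exact ⟨a, b, hab.symm⟩

/-- Since `κ ≠ 0`, the kernel of `dN` is exactly the line through `v`. Flat directions can thus be
compared as lines, with no choice of sign. -/
theorem IsFlatBasis.exists_iff {Φ N : M → E3} {κ : ℝ} {p : M} {v w : TangentSpace (𝓡 2) p}
    (h : IsFlatBasis Φ N κ p v w) (hκ : κ ≠ 0) (u : E3) :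
    (∃ y, surfDiff Φ p y = u ∧ surfDiff N p y = 0) ↔ ∃ a : ℝ, u = a • surfDiff Φ p v := by
  constructor
  · rintro ⟨y, rfl, hy⟩
    obtain ⟨a, b, rfl⟩ := exists_eq_smul_add_smul h.inner_left h.inner_right h.inner_left_right y
    rw [map_add, map_smul, map_smul, h.normal_left, h.normal_right] at hy
    have hb : b = 0 := by
      have := congrArg (fun z => (inner ℝ (surfDiff Φ p w) z : ℝ)) hy
      simp only [smul_zero, zero_add, smul_neg, inner_neg_right, inner_smul_right, h.inner_right,
        inner_zero_right, mul_one, neg_eq_zero, mul_eq_zero, hκ, or_false] at this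
      exact this
    exact ⟨a, by simp [hb]⟩
  · rintro ⟨a, rfl⟩
    exact ⟨a • v, by simp, by simp [h.normal_left]⟩

/-- The projection to the orthogonal complement of a unit vector. -/
def orthPartL (u : E3) : E3 →L[ℝ] E3 :=
  ContinuousLinearMap.id ℝ E3 - (innerSL ℝ u).smulRight u

theorem orthPartL_apply (u x : E3) : orthPartL u x = orthPart u x := by
  simp [orthPartL, orthPart]

theorem contMDiff_clm_comp_add {F G : M → E3} (hF : ContMDiff (𝓡 2) 𝓘(ℝ, E3) ∞ F)
    (hG : ContMDiff (𝓡 2) 𝓘(ℝ, E3) ∞ G) (T : E3 →L[ℝ] E3) (a : ℝ) :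
    ContMDiff (𝓡 2) 𝓘(ℝ, E3) ∞ (fun q => T (F q + a • G q)) :=
  T.contMDiff.comp (hF.add ((a • ContinuousLinearMap.id ℝ E3).contMDiff.comp hG))

variable [IsManifold (𝓡 2) ∞ M]

/-- A totally umbilic immersed surface is an open piece of a plane or a sphere. -/
theorem IsOrientedImmersion.plane_or_sphere_of_umbilic [ConnectedSpace M] {Φ N : M → E3}
    (h : IsOrientedImmersion Φ N) {H : ℝ}
    (hN : ∀ p v, surfDiff N p v = -(H • surfDiff Φ p v)) :
    ∃ P : Set E3, (IsPlane P ∨ IsRoundSphere P) ∧ IsOpenPieceOf (Set.range Φ) P := by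
  obtain ⟨p₀⟩ := (inferInstance : Nonempty M)
  have dΦ : ∀ p, MDifferentiableAt (𝓡 2) 𝓘(ℝ, E3) Φ p := fun p =>
    h.smooth.mdifferentiableAt (by simp)
  have dN : ∀ p, MDifferentiableAt (𝓡 2) 𝓘(ℝ, E3) N p := fun p =>
    h.smooth_normal.mdifferentiableAt (by simp)
  by_cases hH : H = 0
  · obtain ⟨w, hw⟩ := exists_eq_const_of_surfDiff_eq_zero h.smooth_normal
      (fun p v => by simp [hN, hH])
    have hw1 : ‖w‖ = 1 := hw p₀ ▸ h.norm_normal p₀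
    have hww : inner ℝ w w = (1 : ℝ) := by rw [real_inner_self_eq_norm_sq, hw1, one_pow]
    obtain ⟨c, hc⟩ := exists_eq_const_of_surfDiff_eq_zero
      (contMDiff_clm_comp_add h.smooth h.smooth ((innerSL ℝ w).smulRight w) 0) (fun p v => by
        have := h.inner_normal p v
        rw [hw] at this
        rw [surfDiff_clm_comp_add (dΦ p) (dΦ p)]
        simp [this])
    have hd : ∀ p, inner ℝ w (Φ p) = (inner ℝ w c : ℝ) := by
      intro p
      have := congrArg (fun y => (inner ℝ w y : ℝ)) (hc p)
      simpa [inner_smul_right, hww, hw1] using this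
    refine ⟨planeSet w (inner ℝ w c), Or.inl ⟨w, _, hw1, rfl⟩,
      h.isOpenPieceOf one_pos hd fun p t _ ht => ?_⟩
    have ht' : inner ℝ w (Φ p + t • N p) = (inner ℝ w c : ℝ) := ht
    rw [inner_add_right, inner_smul_right, hw, hww, hd] at ht'
    linarith
  -- `Φ + H⁻¹ N` has zero differential; its value is the centre of the sphere.
  · obtain ⟨c, hc⟩ := exists_eq_const_of_surfDiff_eq_zero
      (contMDiff_clm_comp_add h.smooth h.smooth_normal (ContinuousLinearMap.id ℝ E3) H⁻¹)
      (fun p v => by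
        rw [surfDiff_clm_comp_add (dΦ p) (dN p), hN]
        simp [smul_smul, hH])
    have hc' : ∀ p, Φ p - c = (-H⁻¹) • N p := by
      intro p
      rw [← hc p]
      simp
    have hpos : 0 < |H⁻¹| := abs_pos.mpr (inv_ne_zero hH)
    refine ⟨Metric.sphere c |H⁻¹|, Or.inr ⟨c, _, hpos, rfl⟩,
      h.isOpenPieceOf hpos (fun p => ?_) fun p t hlt ht => ?_⟩
    · rw [mem_sphere_iff_norm, hc', norm_smul, h.norm_normal]
      simp
    · rw [mem_sphere_iff_norm, add_sub_right_comm, hc', ← add_smul, norm_smul, h.norm_normal,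
        mul_one, Real.norm_eq_abs, abs_eq_abs] at ht
      rcases ht with ht | ht
      -- The normal line meets the sphere again only at the antipode, outside the tube of radius
      -- `|H⁻¹|`.
      · rw [show t = 2 * H⁻¹ by linarith, abs_mul, abs_two] at hlt
        linarith
      · linarith

/-- An immersed surface with principal curvatures `0` and `κ ≠ 0`, whose flat directions are
locally constant in `ℝ³`, is an open piece of a circular cylinder. -/
theorem IsOrientedImmersion.cylinder_of_flat [ConnectedSpace M] {Φ N : M → E3}
    (h : IsOrientedImmersion Φ N) {κ : ℝ} (hκ : κ ≠ 0)
    (hflat : ∀ p₀, ∃ E : E3, ∀ᶠ p in nhds p₀, ∃ v w, surfDiff Φ p v = E ∧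
      IsFlatBasis Φ N κ p v w) :
    ∃ P : Set E3, IsCircularCylinder P ∧ IsOpenPieceOf (Set.range Φ) P := by
  -- Whether a fixed `u` is a flat direction is locally constant in `p`, so by connectedness the
  -- direction found at `p₀` is flat everywhere.
  have hloc : ∀ u : E3, IsLocallyConstant fun p =>
      ∃ y, surfDiff Φ p y = u ∧ surfDiff N p y = 0 := by
    intro u
    rw [IsLocallyConstant.iff_eventually_eq]
    intro p₀
    obtain ⟨E, hE⟩ := hflat p₀
    have hiff : ∀ᶠ p in nhds p₀, (∃ y, surfDiff Φ p y = u ∧ surfDiff N p y = 0) ↔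
        ∃ a : ℝ, u = a • E := by
      filter_upwards [hE] with p hp
      obtain ⟨v, w, hv, hb⟩ := hp
      rw [hb.exists_iff hκ, hv]
    have h₀ := hiff.self_of_nhds
    filter_upwards [hiff] with p hp
    exact propext (hp.trans h₀.symm)
  obtain ⟨p₀⟩ := (inferInstance : Nonempty M)
  obtain ⟨u, hu⟩ := hflat p₀
  obtain ⟨v₀, w₀, hv₀, hb₀⟩ := hu.self_of_nhds
  have huu : inner ℝ u u = (1 : ℝ) := hv₀ ▸ hb₀.inner_left
  have hu1 : ‖u‖ = 1 := by
    rw [real_inner_self_eq_norm_sq] at huu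
    nlinarith [norm_nonneg u]
  have hall : ∀ p, ∃ y, surfDiff Φ p y = u ∧ surfDiff N p y = 0 := by
    intro p
    have := (hloc u).apply_eq_of_preconnectedSpace p p₀
    exact this.mpr ⟨v₀, hv₀, hb₀.normal_left⟩
  have hTu : orthPartL u u = 0 := by simp [orthPartL_apply, orthPart, hu1]
  have hTN : ∀ p, orthPartL u (N p) = N p := by
    intro p
    obtain ⟨y, hy, -⟩ := hall p
    have := h.inner_normal p y
    rw [hy, real_inner_comm] at this
    simp [orthPartL_apply, orthPart, this]
  -- The projection of `Φ + κ⁻¹ N` orthogonal to `u` is constant: the flat direction is projected to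
  -- zero, and along `w` the two differentials cancel. Its value `c` lies on the axis.
  obtain ⟨c, hc⟩ := exists_eq_const_of_surfDiff_eq_zero
    (contMDiff_clm_comp_add h.smooth h.smooth_normal (orthPartL u) κ⁻¹) (fun p y => by
      rw [surfDiff_clm_comp_add (h.smooth.mdifferentiableAt (by simp))
        (h.smooth_normal.mdifferentiableAt (by simp))]
      obtain ⟨E, hE⟩ := hflat p
      obtain ⟨v, w, -, hb⟩ := hE.self_of_nhds
      obtain ⟨a, ha⟩ := (hb.exists_iff hκ u).mp (hall p)
      have ha0 : a ≠ 0 := by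
        rintro rfl
        simp [ha] at hu1
      have hTv : orthPartL u (surfDiff Φ p v) = 0 := by
        have : a • orthPartL u (surfDiff Φ p v) = 0 := by rw [← map_smul, ← ha, hTu]
        exact (smul_eq_zero.mp this).resolve_left ha0
      obtain ⟨r, t, rfl⟩ :=
        exists_eq_smul_add_smul hb.inner_left hb.inner_right hb.inner_left_right y
      simp only [map_add, map_smul, hb.normal_left, hb.normal_right, hTv, smul_zero, zero_add,
        smul_neg, map_neg]
      rw [smul_comm t κ, smul_smul, inv_mul_cancel₀ hκ, one_smul, add_neg_cancel])
  have hTc : orthPartL u c = c := by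
    rw [← hc p₀]
    simp [orthPartL_apply, orthPart, inner_sub_right, inner_smul_right, hu1]
  have hc' : ∀ p, orthPart u (Φ p - c) = (-κ⁻¹) • N p := by
    intro p
    have := hc p
    rw [map_add, map_smul, hTN] at this
    rw [← orthPartL_apply, map_sub, hTc, ← this]
    simp
  have hpos : 0 < |κ⁻¹| := abs_pos.mpr (inv_ne_zero hκ)
  refine ⟨cylinderSet c u |κ⁻¹|, ⟨c, u, _, hu1, hpos, rfl⟩,
    h.isOpenPieceOf hpos (fun p => ?_) fun p t hlt ht => ?_⟩
  · change ‖orthPart u (Φ p - c)‖ = _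
    rw [hc', norm_smul, h.norm_normal]
    simp
  · change ‖orthPart u (Φ p + t • N p - c)‖ = _ at ht
    rw [add_sub_right_comm, ← orthPartL_apply, map_add, orthPartL_apply, hc', map_smul, hTN,
      ← add_smul, norm_smul, h.norm_normal, mul_one, Real.norm_eq_abs, abs_eq_abs] at ht
    rcases ht with ht | ht
    · rw [show t = 2 * κ⁻¹ by linarith, abs_mul, abs_two] at hlt
      linarith
    · linarith

theorem IsOrientedImmersion.surfDiff_normal_of_umbilic {Φ N : M → E3}
    (h : IsOrientedImmersion Φ N) {H : ℝ} (hH : ∀ p, meanCurvature Φ N p = H) {p : M}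
    (hK : gaussCurvature Φ N p = H ^ 2) (y : TangentSpace (𝓡 2) p) :
    surfDiff N p y = -(H • surfDiff Φ p y) := by
  have hp := mem_chart_source (EuclideanSpace ℝ (Fin 2)) p
  have hx := (chartAt (EuclideanSpace ℝ (Fin 2)) p).map_source hp
  have hleft := (chartAt (EuclideanSpace ℝ (Fin 2)) p).left_inv hp
  obtain ⟨L, hL, hLF⟩ := exists_surfDiff_eq_fderiv p hx
  have key := (h.paramSurface p).fderiv_normal_of_umbilic (h.hasCurvatures hH p) hx
    (by rw [Function.comp_apply, hleft, hK])
  have : ∀ z, surfDiff N ((chartAt (EuclideanSpace ℝ (Fin 2)) p).symm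
      (chartAt (EuclideanSpace ℝ (Fin 2)) p p)) z
      = -(H • surfDiff Φ ((chartAt (EuclideanSpace ℝ (Fin 2)) p).symm
      (chartAt (EuclideanSpace ℝ (Fin 2)) p p)) z) := by
    intro z
    obtain ⟨v, rfl⟩ := hL.2 z
    rw [hLF N h.smooth_normal, hLF Φ h.smooth, key]
  rw [hleft] at this
  exact this y

theorem IsOrientedImmersion.gaussCurvature_le {Φ N : M → E3} (h : IsOrientedImmersion Φ N) {H : ℝ}
    (hH : ∀ p, meanCurvature Φ N p = H) (p : M) : gaussCurvature Φ N p ≤ H ^ 2 := by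
  have hp := mem_chart_source (EuclideanSpace ℝ (Fin 2)) p
  have hx := (chartAt (EuclideanSpace ℝ (Fin 2)) p).map_source hp
  obtain ⟨A, B, f₁, f₂, -, hq⟩ := (h.paramSurface p).exists_shapeFrame (h.hasCurvatures hH p)
  have := hq _ hx
  rw [Function.comp_apply, (chartAt (EuclideanSpace ℝ (Fin 2)) p).left_inv hp] at this
  nlinarith [sq_nonneg (A (chartAt (EuclideanSpace ℝ (Fin 2)) p p)),
    sq_nonneg (B (chartAt (EuclideanSpace ℝ (Fin 2)) p p))]

/-- Near a point which is not umbilic, a shrinker of constant mean curvature is flat with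
parallel flat direction. -/
theorem IsGCFShrinker.flat_of_not_umbilic {Φ N : M → E3} {α lam : ℝ}
    (hs : IsGCFShrinker α lam Φ N) (h : IsOrientedImmersion Φ N) {H : ℝ}
    (hH : ∀ p, meanCurvature Φ N p = H) {p₀ : M} (hK : gaussCurvature Φ N p₀ < H ^ 2) :
    gaussCurvature Φ N p₀ = 0 ∧ ∃ E : E3, ∀ᶠ p in nhds p₀, ∃ v w, surfDiff Φ p v = E ∧
      IsFlatBasis Φ N (2 * H) p v w := by
  have hp := mem_chart_source (EuclideanSpace ℝ (Fin 2)) p₀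
  have hx := (chartAt (EuclideanSpace ℝ (Fin 2)) p₀).map_source hp
  have hleft := (chartAt (EuclideanSpace ℝ (Fin 2)) p₀).left_inv hp
  obtain ⟨U, hU, hxU, s, e₁, e₂, hf, hKs⟩ :=
    (h.paramSurface p₀).exists_principalFrame (h.hasCurvatures hH p₀) hx
      (by rwa [Function.comp_apply, hleft])
  have hsh : ∀ x ∈ U, H ^ 2 - s x ^ 2
      = α * inner ℝ ((N ∘ (chartAt (EuclideanSpace ℝ (Fin 2)) p₀).symm) x)
        ((Φ ∘ (chartAt (EuclideanSpace ℝ (Fin 2)) p₀).symm) x) + lam := by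
    intro x hx
    rw [← hKs x hx]
    exact hs _
  have hsq := hf.sq_eq_sq hsh hxU
  constructor
  · have := hKs _ hxU
    rw [Function.comp_apply, hleft] at this
    linarith
  have hpar : ∃ E : E3, inner ℝ E E = (1 : ℝ) ∧
      ∀ᶠ x in nhds (chartAt (EuclideanSpace ℝ (Fin 2)) p₀ p₀), ∃ v w,
      fderiv ℝ (Φ ∘ (chartAt (EuclideanSpace ℝ (Fin 2)) p₀).symm) x v = E ∧
      fderiv ℝ (N ∘ (chartAt (EuclideanSpace ℝ (Fin 2)) p₀).symm) x v = 0 ∧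
      inner ℝ (fderiv ℝ (Φ ∘ (chartAt (EuclideanSpace ℝ (Fin 2)) p₀).symm) x w)
        (fderiv ℝ (Φ ∘ (chartAt (EuclideanSpace ℝ (Fin 2)) p₀).symm) x w) = (1 : ℝ) ∧
      inner ℝ (fderiv ℝ (Φ ∘ (chartAt (EuclideanSpace ℝ (Fin 2)) p₀).symm) x v)
        (fderiv ℝ (Φ ∘ (chartAt (EuclideanSpace ℝ (Fin 2)) p₀).symm) x w) = (0 : ℝ) ∧
      fderiv ℝ (N ∘ (chartAt (EuclideanSpace ℝ (Fin 2)) p₀).symm) x w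
        = -((2 * H) • fderiv ℝ (Φ ∘ (chartAt (EuclideanSpace ℝ (Fin 2)) p₀).symm) x w) := by
    -- The sign tells which of the two principal directions is flat; `swap` reduces the second case
    -- to the first.
    rcases sq_eq_sq_iff_eq_or_eq_neg.mp hsq with h' | h'
    · exact hf.eventually_parallel hsh hxU h'
    · exact hf.swap.eventually_parallel (by simpa using hsh) hxU (by linarith)
  obtain ⟨E, hE, hev⟩ := hpar
  refine ⟨E, eventually_nhds_of_chartAt p₀ ?_⟩
  filter_upwards [hev, (chartAt (EuclideanSpace ℝ (Fin 2)) p₀).open_target.mem_nhds hx]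
    with x hx' hxt
  obtain ⟨L, hL, hLF⟩ := exists_surfDiff_eq_fderiv p₀ hxt
  obtain ⟨v, w, h₁, h₂, h₃, h₄, h₅⟩ := hx'
  simp only [← hLF Φ h.smooth, ← hLF N h.smooth_normal] at h₁ h₂ h₃ h₄ h₅
  exact ⟨L v, L w, h₁, ⟨by rw [h₁, hE], h₃, h₄, h₂, h₅⟩⟩

theorem IsGCFShrinker.classification [ConnectedSpace M] {Φ N : M → E3} {α lam : ℝ}
    (hs : IsGCFShrinker α lam Φ N) (h : IsOrientedImmersion Φ N)
    (hcmc : HasConstantMeanCurvature Φ N) :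
    ∃ P : Set E3, (IsPlane P ∨ IsRoundSphere P ∨ IsCircularCylinder P) ∧
      IsOpenPieceOf (Set.range Φ) P := by
  obtain ⟨H, hH⟩ := hcmc
  have hcont : Continuous (gaussCurvature Φ N) := by
    rw [show gaussCurvature Φ N = fun p => α * inner ℝ (N p) (Φ p) + lam from funext hs]
    exact (continuous_const.mul (h.smooth_normal.continuous.inner h.smooth.continuous)).add
      continuous_const
  have hval : ∀ p, gaussCurvature Φ N p ∈ ({H ^ 2, 0} : Set ℝ) := by
    intro p
    rcases (h.gaussCurvature_le hH p).eq_or_lt with h' | h'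
    · exact Or.inl h'
    · exact Or.inr (hs.flat_of_not_umbilic h hH h').1
  -- A continuous map from a connected space to a finite set is constant, so umbilic and flat points
  -- cannot coexist unless `H = 0`.
  obtain ⟨k, -, hk⟩ := isPreconnected_univ.eqOn_const_of_mapsTo
    (Set.toFinite ({H ^ 2, 0} : Set ℝ)).isDiscrete hcont.continuousOn (fun p _ => hval p) (by simp)
  obtain ⟨p₀⟩ := (inferInstance : Nonempty M)
  by_cases hkH : k = H ^ 2
  · obtain ⟨P, hP, hP'⟩ := h.plane_or_sphere_of_umbilic (H := H) fun p v =>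
      h.surfDiff_normal_of_umbilic hH ((hk (Set.mem_univ p)).trans hkH) v
    exact ⟨P, hP.imp_right Or.inl, hP'⟩
  · have hlt : ∀ p, gaussCurvature Φ N p < H ^ 2 := fun p =>
      (h.gaussCurvature_le hH p).lt_of_ne fun h' => hkH ((hk (Set.mem_univ p)).symm.trans h')
    have hH0 : H ≠ 0 := by
      rintro rfl
      have := (hs.flat_of_not_umbilic h hH (hlt p₀)).1
      exact (hlt p₀).ne (by rw [this]; simp)
    obtain ⟨P, hP, hP'⟩ := h.cylinder_of_flat (κ := 2 * H) (by simpa using hH0)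
      fun p => (hs.flat_of_not_umbilic h hH (hlt p)).2
    exact ⟨P, Or.inr (Or.inr hP), hP'⟩

/-! ### The converse: planes, spheres and cylinders as shrinkers. -/

theorem IsOrientedImmersion.shrinker_of_plane {Φ N : M → E3} (h : IsOrientedImmersion Φ N)
    {α lam d : ℝ} {w : E3} (hP : Set.range Φ ⊆ planeSet w d) (hN : ∀ p, N p = w)
    (hl : lam = -(α * d)) : IsGCFShrinker α lam Φ N ∧ HasConstantMeanCurvature Φ N := by
  have hcurv : ∀ p, meanCurvature Φ N p = (0 + 0) / 2 ∧ gaussCurvature Φ N p = 0 * 0 - 0 * 0 := by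
    intro p
    obtain ⟨v, y, h₁, h₂, h₃⟩ := h.exists_orthonormal_basis p
    have hN' : N = fun _ => w := funext hN
    exact curvatures_of_orthonormal_basis h p h₁ h₂ h₃ (by simp [hN', surfDiff_const])
      (by simp [hN', surfDiff_const])
  refine ⟨fun p => ?_, 0, fun p => by rw [(hcurv p).1]; simp⟩
  have : inner ℝ w (Φ p) = d := hP ⟨p, rfl⟩
  rw [(hcurv p).2, hN, this, hl]
  ring

theorem IsOrientedImmersion.shrinker_of_sphere {Φ N : M → E3} (h : IsOrientedImmersion Φ N)
    {α lam r : ℝ} (hr : 0 < r) (hP : Set.range Φ ⊆ Metric.sphere 0 r)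
    (hN : ∀ p, N p = -(r⁻¹ • Φ p)) (hl : lam * r ^ 2 - α * r ^ 3 - 1 = 0) :
    IsGCFShrinker α lam Φ N ∧ HasConstantMeanCurvature Φ N := by
  have dN : ∀ p v, surfDiff N p v = -(r⁻¹ • surfDiff Φ p v) := by
    intro p v
    have hd := h.smooth.mdifferentiableAt (x := p) (by simp)
    have hN' : N = fun q => (-(r⁻¹ • ContinuousLinearMap.id ℝ E3)) (Φ q + (0 : ℝ) • Φ q) := by
      funext q
      simp [hN]
    rw [hN', surfDiff_clm_comp_add hd hd]
    simp
  have hcurv : ∀ p, meanCurvature Φ N p = (r⁻¹ + r⁻¹) / 2 ∧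
      gaussCurvature Φ N p = r⁻¹ * r⁻¹ - 0 * 0 := by
    intro p
    obtain ⟨v, y, h₁, h₂, h₃⟩ := h.exists_orthonormal_basis p
    exact curvatures_of_orthonormal_basis h p h₁ h₂ h₃ (by simp [dN]) (by simp [dN])
  have hr0 := hr.ne'
  refine ⟨fun p => ?_, _, fun p => (hcurv p).1⟩
  have hn : ‖Φ p‖ = r := by simpa using hP ⟨p, rfl⟩
  rw [(hcurv p).2, hN, inner_neg_left, inner_smul_left, real_inner_self_eq_norm_sq, hn]
  simp only [conj_trivial]
  field_simp
  linarith

theorem IsOrientedImmersion.shrinker_of_cylinder {Φ N : M → E3} (h : IsOrientedImmersion Φ N)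
    {α lam r : ℝ} {u : E3} (hu : ‖u‖ = 1) (hr : 0 < r) (hP : Set.range Φ ⊆ cylinderSet 0 u r)
    (hN : ∀ p, N p = -(r⁻¹ • orthPart u (Φ p))) (hl : lam - α * r = 0) :
    IsGCFShrinker α lam Φ N ∧ HasConstantMeanCurvature Φ N := by
  have huu : inner ℝ u u = (1 : ℝ) := by rw [real_inner_self_eq_norm_sq, hu, one_pow]
  have hNu : ∀ p, inner ℝ (N p) u = (0 : ℝ) := by
    intro p
    rw [hN, inner_neg_left, inner_smul_left, orthPart, inner_sub_left, inner_smul_left, huu,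
      real_inner_comm]
    simp
  have dN : ∀ p v, surfDiff N p v = -(r⁻¹ • orthPart u (surfDiff Φ p v)) := by
    intro p v
    have hd := h.smooth.mdifferentiableAt (x := p) (by simp)
    have hN' : N = fun q => (-(r⁻¹ • orthPartL u)) (Φ q + (0 : ℝ) • Φ q) := by
      funext q
      simp [hN, orthPartL_apply]
    rw [hN', surfDiff_clm_comp_add hd hd]
    simp [orthPartL_apply]
  have hcurv : ∀ p, meanCurvature Φ N p = r⁻¹ / 2 ∧ gaussCurvature Φ N p = 0 := by
    intro p
    obtain ⟨v, y, h₁, h₂, h₃⟩ := h.exists_orthonormal_basis p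
    have h₃' : inner ℝ (surfDiff Φ p y) (surfDiff Φ p v) = (0 : ℝ) := by
      rw [real_inner_comm]; exact h₃
    have hNN : inner ℝ (N p) (N p) = (1 : ℝ) := by
      rw [real_inner_self_eq_norm_sq, h.norm_normal, one_pow]
    set a : ℝ := inner ℝ u (surfDiff Φ p v) with ha
    set b : ℝ := inner ℝ u (surfDiff Φ p y) with hb
    have hu' : u = a • surfDiff Φ p v + b • surfDiff Φ p y := by
      refine eq_of_inner_orthonormal h₁ h₂ hNN h₃
        (by rw [real_inner_comm]; exact h.inner_normal p v)
        (by rw [real_inner_comm]; exact h.inner_normal p y) ?_ ?_ ?_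
      · rw [inner_add_right, inner_smul_right, inner_smul_right, h₁, h₃, real_inner_comm, ← ha]
        ring
      · rw [inner_add_right, inner_smul_right, inner_smul_right, h₂, h₃', real_inner_comm, ← hb]
        ring
      · rw [inner_add_right, inner_smul_right, inner_smul_right, h.inner_normal, h.inner_normal,
          hNu]
        ring
    have hab : a ^ 2 + b ^ 2 = 1 := by
      have e : (inner ℝ u (a • surfDiff Φ p v + b • surfDiff Φ p y) : ℝ) = 1 := by
        rw [← hu', huu]
      rw [inner_add_right, inner_smul_right, inner_smul_right, ← ha, ← hb] at e
      linarith
    -- The basis need not be adapted to the axis: `S = r⁻¹(1 - u uᵀ)`, where `u = (a, b)` is a unit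
    -- tangent vector, so the determinant is `r⁻²(1 - a² - b²) = 0`.
    have key := curvatures_of_orthonormal_basis h p h₁ h₂ h₃ (a := r⁻¹ * (1 - a ^ 2))
      (b := -(r⁻¹ * (a * b))) (c := -(r⁻¹ * (a * b))) (d := r⁻¹ * (1 - b ^ 2))
      (by
        rw [dN, orthPart, ← ha]
        conv_lhs => rw [hu']
        module)
      (by
        rw [dN, orthPart, ← hb]
        conv_lhs => rw [hu']
        module)
    rw [key.1, key.2]
    constructor
    · linear_combination (-r⁻¹ / 2) * hab
    · linear_combination (-r⁻¹ ^ 2) * hab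
  refine ⟨fun p => ?_, _, fun p => (hcurv p).1⟩
  have hn : ‖orthPart u (Φ p)‖ = r := by
    have : ‖orthPart u (Φ p - 0)‖ = r := hP ⟨p, rfl⟩
    simpa using this
  have hr0 := hr.ne'
  have hin : inner ℝ (N p) (Φ p) = -r := by
    have e : Φ p = orthPart u (Φ p) + (inner ℝ u (Φ p) : ℝ) • u := by simp [orthPart]
    conv_lhs => rw [e]
    rw [inner_add_right, inner_smul_right, hNu, hN, inner_neg_left, inner_smul_left,
      real_inner_self_eq_norm_sq, hn]
    simp only [conj_trivial]
    field_simp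
    ring
  rw [(hcurv p).2, hin]
  linarith


end

end

theorem theorem1p2 {M : Type*} [TopologicalSpace M] [ConnectedSpace M]
    [ChartedSpace (EuclideanSpace ℝ (Fin 2)) M] [IsManifold (𝓡 2) ∞ M]
    (Φ N : M → E3) (hΦ : IsOrientedImmersion Φ N) (α lam : ℝ) (hα : α ≠ 0) :
    -- constant mean curvature shrinkers are planes, spheres or circular cylinders
    (IsGCFShrinker α lam Φ N → HasConstantMeanCurvature Φ N →
      ∃ P : Set E3, (IsPlane P ∨ IsRoundSphere P ∨ IsCircularCylinder P) ∧
        IsOpenPieceOf (Set.range Φ) P) ∧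
    -- planes are such surfaces
    (∀ (w : E3) (d : ℝ), ‖w‖ = 1 → Set.range Φ ⊆ planeSet w d → (∀ p, N p = w) →
      lam = -(α * d) →
      IsGCFShrinker α lam Φ N ∧ HasConstantMeanCurvature Φ N) ∧
    -- spheres centred at the origin, with the inward normal, are such surfaces
    (∀ r : ℝ, 0 < r → Set.range Φ ⊆ Metric.sphere 0 r → (∀ p, N p = -(r⁻¹ • Φ p)) →
      lam * r ^ 2 - α * r ^ 3 - 1 = 0 →
      IsGCFShrinker α lam Φ N ∧ HasConstantMeanCurvature Φ N) ∧
    -- circular cylinders around an axis through the origin, with the inward normal, are such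
    -- surfaces
    (∀ (u : E3) (r : ℝ), ‖u‖ = 1 → 0 < r → Set.range Φ ⊆ cylinderSet 0 u r →
      (∀ p, N p = -(r⁻¹ • orthPart u (Φ p))) → lam - α * r = 0 →
      IsGCFShrinker α lam Φ N ∧ HasConstantMeanCurvature Φ N) := by
  exact ⟨fun hs hH => hs.classification hΦ hH,
    fun w d _ hP hN hl => hΦ.shrinker_of_plane hP hN hl,
    fun r hr hP hN hl => hΦ.shrinker_of_sphere hr hP hN hl,
    fun u r hu hr hP hN hl => hΦ.shrinker_of_cylinder hu hr hP hN hl⟩
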